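/- Let $\mathcal H$ and $\mathcal K$ be complex Hilbert spaces. For a linear operator $S$ in $\mathcal H$ with domain $\operatorname{dom}(S)\subseteq\mathcal H$, let $\rho(S)$ be the set of all $z\in\mathbb C$ for which $S-zI$ maps $\operatorname{dom}(S)$ bijectively onto $\mathcal H$ with bounded inverse. The operator $S$ is called m-accretive if for every $\zeta\in\mathbb C$ with $\operatorname{Re}\zeta>0$ one has $-\zeta\in\rho(S)$ and $\|(S+\zeta I)^{-1}\|\le(\operatorname{Re}\zeta)^{-1}$. Its square root $S^{1/2}$ is then the closure of the operator $$x\mapsto\frac1\pi\int_0^\infty\lambda^{-1/2}(S+\lambda I)^{-1}Sx\,d\lambda,\qquad x\in\operatorname{dom}(S)$$ (equivalently, the unique m-accretive operator whose square is $S$), and $(S+EI)^{-1/2}:=((S+EI)^{1/2})^{-1}$ for $E>0$. Products of operators have their natural domains, and an overline denotes the closure of an operator. Let $T_0$ be a densely defined, closed, linear operator in $\mathcal H$ with $\rho(T_0)\neq\emptyset$, and let $A$ and $B$ be densely defined, closed, linear operators from $\mathcal H$ to $\mathcal K$ such that $\operatorname{dom}(A)\supseteq\operatorname{dom}(T_0)$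 and $\operatorname{dom}(B)\supseteq\operatorname{dom}(T_0^*)$. Suppose that for some (and hence for all) $z\in\rho(T_0)$ the operator $-A(T_0-zI)^{-1}B^*$, defined on $\operatorname{dom}(B^*)$, has a bounded extension to $\mathcal K$; put $K(z)=\overline{-A(T_0-zI)^{-1}B^*}$. Suppose that the set $\mathcal Z=\{z\in\rho(T_0): 1\in\rho(K(z))\}$ is nonempty, and for $z\in\mathcal Z$ put $$R(z)=(T_0-zI)^{-1}-\overline{(T_0-zI)^{-1}B^*}\,[I-K(z)]^{-1}A(T_0-zI)^{-1}.$$ Let $T$ be the operator in $\mathcal H$ determined by $(T-zI)^{-1}=R(z)$ for all $z\in\mathcal Z$. Suppose further that $T_0$ is m-accretive, that $$\operatorname{dom}(A)\supseteq\operatorname{dom}(T_0^{1/2}),\qquad \operatorname{dom}(B)\supseteq\operatorname{dom}((T_0^*)^{1/2}),$$ and that, with $$\nu(E)=\big\|A(T_0+EI)^{-1/2}\big\|\;\big\|\overline{(T_0+EI)^{-1/2}B^*}\big\|,\qquad E>0,$$ there are constants $\varrho>0$ and $E_0>0$ such that $$\int_{\varrho}^\infty\lambda^{-1}\nu(\lambda+E)\,d\lambda<\infty\quad\text{for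 all }E\ge E_0,$$ $$\lim_{E\to\infty}\int_{\varrho}^\infty\lambda^{-1}\nu(\lambda+E)\,d\lambda=0,\qquad \lim_{E\to\infty}\nu(E)=0.$$ Suppose also that $\operatorname{dom}(T_0^{1/2})=\operatorname{dom}((T_0^*)^{1/2})$. If $T$ is m-accretive, then $$\operatorname{dom}(T^{1/2})=\operatorname{dom}(T_0^{1/2})=\operatorname{dom}((T_0^*)^{1/2})=\operatorname{dom}((T^*)^{1/2}).$$ -/

import Mathlib

open MeasureTheory Filter Topology

noncomputable section

namespace KatoSum

section Operators

variable {E F G : Type*}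
  [NormedAddCommGroup E] [InnerProductSpace ℂ E]
  [NormedAddCommGroup F] [InnerProductSpace ℂ F]
  [NormedAddCommGroup G] [InnerProductSpace ℂ G]

/-- The product `g f` of two partially defined operators on its natural domain
`{x ∈ dom f | f x ∈ dom g}`. -/
def pmul (g : F →ₗ.[ℂ] G) (f : E →ₗ.[ℂ] F) : E →ₗ.[ℂ] G where
  domain :=
    { carrier := {x | ∃ hx : x ∈ f.domain, f ⟨x, hx⟩ ∈ g.domain}
      zero_mem' := ⟨f.domain.zero_mem, by
        have h : f ⟨0, f.domain.zero_mem⟩ = 0 := f.map_zero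
        rw [h]; exact g.domain.zero_mem⟩
      add_mem' := by
        rintro x y ⟨hx, hx'⟩ ⟨hy, hy'⟩
        refine ⟨f.domain.add_mem hx hy, ?_⟩
        have h : f ⟨x + y, f.domain.add_mem hx hy⟩ = f ⟨x, hx⟩ + f ⟨y, hy⟩ :=
          f.map_add ⟨x, hx⟩ ⟨y, hy⟩
        rw [h]; exact g.domain.add_mem hx' hy'
      smul_mem' := by
        rintro c x ⟨hx, hx'⟩
        refine ⟨f.domain.smul_mem c hx, ?_⟩
        have h : f ⟨c • x, f.domain.smul_mem c hx⟩ = c • f ⟨x, hx⟩ := f.map_smul c ⟨x, hx⟩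
        rw [h]; exact g.domain.smul_mem c hx' }
  toFun :=
    { toFun := fun x => g ⟨f ⟨x, x.2.choose⟩, x.2.choose_spec⟩
      map_add' := by
        rintro ⟨x, hx, hx'⟩ ⟨y, hy, hy'⟩
        rw [← g.map_add]
        exact congrArg g (Subtype.ext (f.map_add ⟨x, hx⟩ ⟨y, hy⟩))
      map_smul' := by
        rintro c ⟨x, hx, hx'⟩
        rw [RingHom.id_apply, ← g.map_smul]
        exact congrArg g (Subtype.ext (f.map_smul c ⟨x, hx⟩)) }

/-- A bounded, everywhere defined operator as a partially defined one. -/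
def ofCLM (C : E →L[ℂ] F) : E →ₗ.[ℂ] F := (C : E →ₗ[ℂ] F).toPMap ⊤

open scoped Classical in
/-- The closure of `f` as an element of the space of bounded operators; it is the (then unique)
bounded, everywhere defined `C` that is the closure of `f`, and `0` if there is none. -/
def bddClosure (f : E →ₗ.[ℂ] F) : E →L[ℂ] F :=
  if h : ∃ C : E →L[ℂ] F, f.closure = ofCLM C then h.choose else 0

/-- `T + c I`, with domain `dom T`. -/
def shift (T : E →ₗ.[ℂ] E) (c : ℂ) : E →ₗ.[ℂ] E := (c • LinearMap.id : E →ₗ[ℂ] E) +ᵥ T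

/-- `R` is the bounded, everywhere defined inverse of `T - z I`. -/
def IsResolvent (T : E →ₗ.[ℂ] E) (z : ℂ) (R : E →L[ℂ] E) : Prop :=
  (∀ y : E, ∃ h : R y ∈ T.domain, T ⟨R y, h⟩ - z • R y = y) ∧
    ∀ x : T.domain, R (T x - z • (x : E)) = x

/-- The resolvent set of `T`. -/
def resSet (T : E →ₗ.[ℂ] E) : Set ℂ := {z | ∃ R : E →L[ℂ] E, IsResolvent T z R}

open scoped Classical in
/-- The resolvent `(T - z I)⁻¹`, for `z` in the resolvent set of `T` (and `0` elsewhere). -/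
def res (T : E →ₗ.[ℂ] E) (z : ℂ) : E →L[ℂ] E :=
  if h : ∃ R : E →L[ℂ] E, IsResolvent T z R then h.choose else 0

/-- `T` is m-accretive: `(T + ζ I)⁻¹` is bounded with norm at most `(Re ζ)⁻¹` if `Re ζ > 0`. -/
def IsMAccretive (T : E →ₗ.[ℂ] E) : Prop :=
  ∀ ζ : ℂ, 0 < ζ.re → -ζ ∈ resSet T ∧ ‖res T (-ζ)‖ ≤ ζ.re⁻¹

/-- The integrand `λ ^ (-1/2) (T + λ I)⁻¹ T x` in the Balakrishnan formula. -/
def sqrtIntegrand (T : E →ₗ.[ℂ] E) (x : T.domain) (l : ℝ) : E :=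
  l ^ (-(1 / 2) : ℝ) • res T (-(l : ℂ)) (T x)

theorem sqrtIntegrand_add (T : E →ₗ.[ℂ] E) (x y : T.domain) :
    sqrtIntegrand T (x + y) = sqrtIntegrand T x + sqrtIntegrand T y := by
  funext l
  simp only [sqrtIntegrand, Pi.add_apply, LinearPMap.map_add, _root_.map_add, smul_add]

theorem sqrtIntegrand_smul (T : E →ₗ.[ℂ] E) (c : ℂ) (x : T.domain) :
    sqrtIntegrand T (c • x) = c • sqrtIntegrand T x := by
  funext l
  simp only [sqrtIntegrand, Pi.smul_apply, LinearPMap.map_smul, _root_.map_smul]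
  exact smul_comm _ _ _

/-- The Balakrishnan operator
`x ↦ (1 / π) ∫_0^∞ λ ^ (-1/2) (T + λ I)⁻¹ T x dλ`, defined for those `x ∈ dom T` for which the
integral converges absolutely (for m-accretive `T` these are all `x ∈ dom T`). -/
def balakrishnan (T : E →ₗ.[ℂ] E) : E →ₗ.[ℂ] E where
  domain :=
    { carrier := {x | ∃ hx : x ∈ T.domain, IntegrableOn (sqrtIntegrand T ⟨x, hx⟩) (Set.Ioi 0)}
      zero_mem' := ⟨T.domain.zero_mem, by
        have h : sqrtIntegrand T ⟨0, T.domain.zero_mem⟩ = 0 := by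
          have h' := sqrtIntegrand_smul T 0 0
          rw [zero_smul, zero_smul] at h'
          exact h'
        rw [h]; exact integrableOn_zero⟩
      add_mem' := by
        rintro x y ⟨hx, hx'⟩ ⟨hy, hy'⟩
        refine ⟨T.domain.add_mem hx hy, ?_⟩
        have h := sqrtIntegrand_add T ⟨x, hx⟩ ⟨y, hy⟩
        exact h ▸ hx'.add hy'
      smul_mem' := by
        rintro c x ⟨hx, hx'⟩
        refine ⟨T.domain.smul_mem c hx, ?_⟩
        have h := sqrtIntegrand_smul T c ⟨x, hx⟩
        exact h ▸ Integrable.smul c hx' }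
  toFun :=
    { toFun := fun x => (1 / Real.pi : ℝ) •
        ∫ l in Set.Ioi (0 : ℝ), sqrtIntegrand T ⟨x, x.2.choose⟩ l
      map_add' := by
        rintro ⟨x, hx, hx'⟩ ⟨y, hy, hy'⟩
        rw [← smul_add]
        congr 1
        exact (congrArg (fun u : ℝ → E => ∫ l in Set.Ioi (0 : ℝ), u l)
          (sqrtIntegrand_add T ⟨x, hx⟩ ⟨y, hy⟩)).trans (integral_add hx' hy')
      map_smul' := by
        rintro c ⟨x, hx, hx'⟩
        rw [RingHom.id_apply, smul_comm c]
        congr 1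
        exact (congrArg (fun u : ℝ → E => ∫ l in Set.Ioi (0 : ℝ), u l)
          (sqrtIntegrand_smul T c ⟨x, hx⟩)).trans (integral_smul c _) }

/-- The square root `T ^ (1/2)` of an m-accretive operator `T` (Balakrishnan's definition): the
closure of the Balakrishnan operator. It is the unique m-accretive operator whose square is
`T`. -/
def sqrt (T : E →ₗ.[ℂ] E) : E →ₗ.[ℂ] E := (balakrishnan T).closure

/-- `(T + e I) ^ (-1/2)`, the inverse of the square root of `T + e I`. -/
def invSqrt (T : E →ₗ.[ℂ] E) (e : ℝ) : E →ₗ.[ℂ] E := (sqrt (shift T e)).inverse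

end Operators

section Perturbation

variable {H K : Type*}
  [NormedAddCommGroup H] [InnerProductSpace ℂ H] [CompleteSpace H]
  [NormedAddCommGroup K] [InnerProductSpace ℂ K] [CompleteSpace K]

/-- The operator `-A (T₀ - z I)⁻¹ B*` on its natural domain, which is `dom B*` if
`dom T₀ ⊆ dom A` and `z` is in the resolvent set of `T₀`. -/
def preK (T₀ : H →ₗ.[ℂ] H) (A B : H →ₗ.[ℂ] K) (z : ℂ) : K →ₗ.[ℂ] K :=
  -(pmul A (pmul (ofCLM (res T₀ z)) B.adjoint))

/-- The bounded operator `K(z)`, the closure of `-A (T₀ - z I)⁻¹ B*`. -/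
def opK (T₀ : H →ₗ.[ℂ] H) (A B : H →ₗ.[ℂ] K) (z : ℂ) : K →L[ℂ] K :=
  bddClosure (preK T₀ A B z)

/-- The set of all `z` in the resolvent set of `T₀` with `1` in the resolvent set of `K(z)`. -/
def admissible (T₀ : H →ₗ.[ℂ] H) (A B : H →ₗ.[ℂ] K) : Set ℂ :=
  {z | z ∈ resSet T₀ ∧ (1 : ℂ) ∈ resolventSet ℂ (opK T₀ A B z)}

/-- The conditions on `T₀`, `A` and `B` under which the generalized sum of `T₀` and `B* A` is
defined. -/
structure SumHyp (T₀ : H →ₗ.[ℂ] H) (A B : H →ₗ.[ℂ] K) : Prop where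
  dense_T₀ : Dense (T₀.domain : Set H)
  closed_T₀ : T₀.IsClosed
  resSet_nonempty : (resSet T₀).Nonempty
  dense_A : Dense (A.domain : Set H)
  closed_A : A.IsClosed
  dense_B : Dense (B.domain : Set H)
  closed_B : B.IsClosed
  dom_A : T₀.domain ≤ A.domain
  dom_B : T₀.adjoint.domain ≤ B.domain
  bounded : ∃ z ∈ resSet T₀, ∃ C : K →L[ℂ] K, preK T₀ A B z ≤ ofCLM C
  admissible_nonempty : (admissible T₀ A B).Nonempty

/-- `R(z) = (T₀ - z I)⁻¹ - cl((T₀ - z I)⁻¹ B*) (I - K(z))⁻¹ A (T₀ - z I)⁻¹`, where `cl` denotes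
the closure. -/
def opR (T₀ : H →ₗ.[ℂ] H) (A B : H →ₗ.[ℂ] K) (z : ℂ) : H →L[ℂ] H :=
  res T₀ z - bddClosure (pmul (ofCLM (res T₀ z)) B.adjoint) ∘L
    Ring.inverse (1 - opK T₀ A B z) ∘L bddClosure (pmul A (ofCLM (res T₀ z)))

/-- All pairs `(x, y)` with `R(z) (y - z x) = x` for every admissible `z`. -/
def sumGraph (T₀ : H →ₗ.[ℂ] H) (A B : H →ₗ.[ℂ] K) : Submodule ℂ (H × H) where
  carrier := {p | ∀ z ∈ admissible T₀ A B, opR T₀ A B z (p.2 - z • p.1) = p.1}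
  zero_mem' := by intro z _; simp
  add_mem' := by
    intro p q hp hq z hz
    have h : (p + q).2 - z • (p + q).1 = (p.2 - z • p.1) + (q.2 - z • q.1) := by
      simp only [Prod.snd_add, Prod.fst_add, smul_add]; abel
    rw [h, _root_.map_add, hp z hz, hq z hz, Prod.fst_add]
  smul_mem' := by
    intro c p hp z hz
    have h : (c • p).2 - z • (c • p).1 = c • (p.2 - z • p.1) := by
      simp only [Prod.smul_snd, Prod.smul_fst, smul_sub, smul_comm c]
    rw [h, _root_.map_smul, hp z hz, Prod.smul_fst]

/-- The generalized sum `T` of `T₀` and `B* A`: the operator with `(T - z I)⁻¹ = R(z)` for every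
admissible `z`, that is, `T x = y` if and only if `R(z) (y - z x) = x` for all these `z`. -/
def genSum (T₀ : H →ₗ.[ℂ] H) (A B : H →ₗ.[ℂ] K) : H →ₗ.[ℂ] H :=
  (sumGraph T₀ A B).toLinearPMap

/-- The norm of `A (T₀ + e I) ^ (-1/2)`. -/
def normA (T₀ : H →ₗ.[ℂ] H) (A : H →ₗ.[ℂ] K) (e : ℝ) : ℝ :=
  ‖bddClosure (pmul A (invSqrt T₀ e))‖

/-- The norm of the closure of `(T₀ + e I) ^ (-1/2) B*`. -/
def normB (T₀ : H →ₗ.[ℂ] H) (B : H →ₗ.[ℂ] K) (e : ℝ) : ℝ :=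
  ‖bddClosure (pmul (invSqrt T₀ e) B.adjoint)‖

/-- The conditions on square root domains and on the decay of `A (T₀ + e I) ^ (-1/2)` and
`(T₀ + e I) ^ (-1/2) B*`. -/
structure SqrtHyp (T₀ : H →ₗ.[ℂ] H) (A B : H →ₗ.[ℂ] K) : Prop where
  mAccretive : IsMAccretive T₀
  dom_A : (sqrt T₀).domain ≤ A.domain
  dom_B : (sqrt T₀.adjoint).domain ≤ B.domain
  decay : ∃ R > (0 : ℝ), ∃ E₀ > (0 : ℝ),
    (∀ e ≥ E₀, IntegrableOn (fun l : ℝ => l⁻¹ * (normA T₀ A (l + e) * normB T₀ B (l + e)))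
      (Set.Ioi R)) ∧
    Tendsto (fun e : ℝ => ∫ l in Set.Ioi R, l⁻¹ * (normA T₀ A (l + e) * normB T₀ B (l + e)))
      atTop (𝓝 0) ∧
    Tendsto (fun e : ℝ => normA T₀ A e * normB T₀ B e) atTop (𝓝 0)
  dom_eq : (sqrt T₀).domain = (sqrt T₀.adjoint).domain

end Perturbation

end KatoSum

end

/-!
Write `J(e) = (T₀ + e) ^ (-1/2) = (1 / π) ∫_0^∞ λ ^ (-1/2) (T₀ + e + λ)⁻¹ dλ` for `e > 0`. The domain
of the square root of an m-accretive operator is the range of this bounded operator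
(`HasContractiveResolvents.sqrt_domain`), so the square root domains of `T` and `T₀` agree as soon
as `(T + E) ^ (-1/2) = J(E) (I - S)` with `‖S‖ < 1` for one `E > 0`.

With the bounded operators `P(e) = A J(e)` and `Q(e) = cl(J(e) B*)`, whose norms have the product
`ν(e)`, one has `K(-e) = -P(e) Q(e)`, and the resolvent of `T` is
`(T + e)⁻¹ = (T₀ + e)⁻¹ - J(e) X(e) J(e)` with `X(e) = Q(e) (I + P(e) Q(e))⁻¹ P(e)`, for all `e` for
which `ν(e)` is small (`negRes_genSum`). Here m-accretivity of `T` provides the existence of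
`(T + e)⁻¹`, and the injectivity of the right-hand side makes the graph that defines `T`
single-valued. Next, `J(f) = J(e) M = M J(e)` for `e ≤ f`, where
`M = (T₀ + e) ^ (1/2) (T₀ + f) ^ (-1/2)` is bounded by `2`
(`IsResolventFamily.negHalf_mul_sqrtRatio`, `IsResolventFamily.norm_sqrtRatio_le`), because
`(T₀ + f) ^ (1/2) - (T₀ + e) ^ (1/2)` is bounded. Inserting both facts into the integral for
`(T + E) ^ (-1/2)` gives `S = (1 / π) ∫_0^∞ λ ^ (-1/2) M X(λ + E) J(λ + E) dλ`, whose integrand is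
bounded by `4 λ ^ (-1/2) (λ + E) ^ (-1/2) ν(λ + E)`. The decay conditions on `ν` make its norm small
for large `E` (`halfMean_estimate`, `exists_negRoot_genSum_eq`).

In the same way `(T + E) ^ (-1/2) = (I - S') J(E)` with `‖S'‖ < 1`. The adjoint of this identity
compares `T*` with `T₀*`, since `((T + E) ^ (-1/2))* = (T* + E) ^ (-1/2)`.

That `J(e) ^ 2 = (T₀ + e)⁻¹` is proved for families `R(λ)` in a Banach algebra that satisfy the
resolvent identity and `‖R(λ)‖ ≤ 1 / λ` (`IsResolventFamily.negHalf_mul_self`): integration by parts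
gives `J' = -(1/2) R J`, so `J ^ 2` satisfies the same differential equation as `R`, and the two have
the same behaviour at infinity.
-/

noncomputable section

namespace KatoSum

/-! ### Weighted means and families of resolvents -/

section HalfMean

variable {X Y : Type*} [NormedAddCommGroup X] [NormedSpace ℝ X]
  [NormedAddCommGroup Y] [NormedSpace ℝ Y]

theorem rpow_neg_half_eq (l : ℝ) (hl : 0 ≤ l) : l ^ (-(1 / 2) : ℝ) = (√l)⁻¹ := by
  rw [Real.rpow_neg hl, Real.sqrt_eq_rpow]

/-- An antiderivative of `λ ^ (-1/2) / (λ + e)` is `2 e ^ (-1/2) arctan (√(λ / e))`. -/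
theorem integral_rpow_neg_half_mul_inv_add {e : ℝ} (he : 0 < e) :
    IntegrableOn (fun l : ℝ => l ^ (-(1 / 2) : ℝ) * (l + e)⁻¹) (Set.Ioi 0) ∧
      ∫ l in Set.Ioi (0 : ℝ), l ^ (-(1 / 2) : ℝ) * (l + e)⁻¹ = Real.pi / √e := by
  have hse : 0 < √e := Real.sqrt_pos.2 he
  have hcont : ContinuousWithinAt (fun l : ℝ => 2 / √e * Real.arctan (√l / √e))
      (Set.Ici 0) 0 := by
    have : Continuous (fun l : ℝ => 2 / √e * Real.arctan (√l / √e)) := by fun_prop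
    exact this.continuousWithinAt
  have hderiv : ∀ l ∈ Set.Ioi (0 : ℝ),
      HasDerivAt (fun l : ℝ => 2 / √e * Real.arctan (√l / √e))
        (l ^ (-(1 / 2) : ℝ) * (l + e)⁻¹) l := by
    intro l hl
    have hl : 0 < l := hl
    have hsl : 0 < √l := Real.sqrt_pos.2 hl
    have h := (((Real.hasDerivAt_sqrt hl.ne').div_const √e).arctan).const_mul (2 / √e)
    refine h.congr_deriv ?_
    rw [rpow_neg_half_eq l hl.le, div_pow, Real.sq_sqrt hl.le, Real.sq_sqrt he.le]
    field_simp
    rw [Real.sq_sqrt he.le]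
    ring
  have hpos : ∀ l ∈ Set.Ioi (0 : ℝ), 0 ≤ l ^ (-(1 / 2) : ℝ) * (l + e)⁻¹ := by
    intro l hl
    have hl : 0 < l := hl
    positivity
  have hlim : Tendsto (fun l : ℝ => 2 / √e * Real.arctan (√l / √e)) atTop
      (𝓝 (2 / √e * (Real.pi / 2))) := by
    refine Tendsto.const_mul _ ?_
    have h1 : Tendsto (fun l : ℝ => √l / √e) atTop atTop :=
      Real.tendsto_sqrt_atTop.atTop_div_const hse
    exact (tendsto_nhds_of_tendsto_nhdsWithin Real.tendsto_arctan_atTop).comp h1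
  refine ⟨integrableOn_Ioi_deriv_of_nonneg hcont hderiv hpos hlim, ?_⟩
  rw [integral_Ioi_of_hasDerivAt_of_nonneg hcont hderiv hpos hlim]
  simp only [Real.sqrt_zero, zero_div, Real.arctan_zero, mul_zero, sub_zero]
  ring

/-- The weighted mean `(1 / π) ∫_0^∞ λ ^ (-1/2) F(λ) dλ`. Applied to `F(λ) = (T + e + λ)⁻¹` it
gives `(T + e) ^ (-1/2)`. -/
def halfMean (F : ℝ → X) : X :=
  Real.pi⁻¹ • ∫ l in Set.Ioi (0 : ℝ), l ^ (-(1 / 2) : ℝ) • F l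

theorem continuousOn_rpow_neg_half :
    ContinuousOn (fun l : ℝ => l ^ (-(1 / 2) : ℝ)) (Set.Ioi 0) := by
  intro l hl
  exact (Real.continuousAt_rpow_const l _ (Or.inl (ne_of_gt hl))).continuousWithinAt

theorem integrableOn_halfMean {F : ℝ → X} {c e : ℝ} (he : 0 < e)
    (hF : ContinuousOn F (Set.Ioi 0)) (hb : ∀ l, 0 < l → ‖F l‖ ≤ c * (l + e)⁻¹) :
    IntegrableOn (fun l : ℝ => l ^ (-(1 / 2) : ℝ) • F l) (Set.Ioi 0) := by
  refine ((integral_rpow_neg_half_mul_inv_add he).1.const_mul c).mono'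
    ((continuousOn_rpow_neg_half.smul hF).aestronglyMeasurable measurableSet_Ioi) ?_
  refine (ae_restrict_iff' measurableSet_Ioi).2 (Eventually.of_forall fun l hl => ?_)
  have hl : 0 < l := hl
  have hw : 0 ≤ l ^ (-(1 / 2) : ℝ) := by positivity
  rw [norm_smul, Real.norm_of_nonneg hw]
  calc l ^ (-(1 / 2) : ℝ) * ‖F l‖ ≤ l ^ (-(1 / 2) : ℝ) * (c * (l + e)⁻¹) := by
        gcongr; exact hb l hl
    _ = c * (l ^ (-(1 / 2) : ℝ) * (l + e)⁻¹) := by ring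

theorem norm_halfMean_le {F : ℝ → X} {c e : ℝ} (he : 0 < e)
    (hb : ∀ l, 0 < l → ‖F l‖ ≤ c * (l + e)⁻¹) : ‖halfMean F‖ ≤ c * (√e)⁻¹ := by
  have h := norm_integral_le_of_norm_le (μ := volume.restrict (Set.Ioi (0 : ℝ)))
    (f := fun l : ℝ => l ^ (-(1 / 2) : ℝ) • F l)
    ((integral_rpow_neg_half_mul_inv_add he).1.const_mul c) (by
      refine (ae_restrict_iff' measurableSet_Ioi).2 (Eventually.of_forall fun l hl => ?_)
      have hl : 0 < l := hl
      have hw : 0 ≤ l ^ (-(1 / 2) : ℝ) := by positivity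
      rw [norm_smul, Real.norm_of_nonneg hw]
      calc l ^ (-(1 / 2) : ℝ) * ‖F l‖ ≤ l ^ (-(1 / 2) : ℝ) * (c * (l + e)⁻¹) := by
            gcongr; exact hb l hl
        _ = c * (l ^ (-(1 / 2) : ℝ) * (l + e)⁻¹) := by ring)
  rw [integral_const_mul, (integral_rpow_neg_half_mul_inv_add he).2] at h
  rw [halfMean, norm_smul, Real.norm_of_nonneg (inv_nonneg.2 Real.pi_pos.le)]
  calc Real.pi⁻¹ * _ ≤ Real.pi⁻¹ * (c * (Real.pi / √e)) := by
        gcongr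
    _ = c * (√e)⁻¹ := by
        have := Real.pi_ne_zero
        field_simp

theorem halfMean_inv_add {e : ℝ} (he : 0 < e) :
    halfMean (fun l : ℝ => (l + e)⁻¹) = (√e)⁻¹ := by
  simp only [halfMean, smul_eq_mul]
  rw [(integral_rpow_neg_half_mul_inv_add he).2]
  have := Real.pi_ne_zero
  field_simp

theorem halfMean_congr {F G : ℝ → X} (h : ∀ l, 0 < l → F l = G l) : halfMean F = halfMean G := by
  rw [halfMean, halfMean]
  congr 1
  exact setIntegral_congr_fun measurableSet_Ioi fun l hl => by rw [h l hl]

theorem halfMean_sub {F G : ℝ → X}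
    (hF : IntegrableOn (fun l : ℝ => l ^ (-(1 / 2) : ℝ) • F l) (Set.Ioi 0))
    (hG : IntegrableOn (fun l : ℝ => l ^ (-(1 / 2) : ℝ) • G l) (Set.Ioi 0)) :
    halfMean (fun l => F l - G l) = halfMean F - halfMean G := by
  simp only [halfMean, smul_sub]
  rw [integral_sub hF hG, smul_sub]

theorem map_halfMean [CompleteSpace X] [CompleteSpace Y] (L : X →L[ℝ] Y) {F : ℝ → X}
    (hF : IntegrableOn (fun l : ℝ => l ^ (-(1 / 2) : ℝ) • F l) (Set.Ioi 0)) :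
    halfMean (fun l => L (F l)) = L (halfMean F) := by
  simp only [halfMean, map_smul]
  rw [← L.integral_comp_comm hF]
  simp only [map_smul]

end HalfMean

/-- The algebraic and metric properties of the resolvents `R(λ) = (T + λ)⁻¹`, `λ > 0`, of an
m-accretive operator that its fractional powers depend on, for a family in a Banach algebra.
The condition `eq_zero` expresses that the resolvents are injective. -/
structure IsResolventFamily {𝔸 : Type*} [NormedRing 𝔸] [NormedAlgebra ℝ 𝔸] (R : ℝ → 𝔸) :
    Prop where
  norm_le : ∀ l, 0 < l → ‖R l‖ ≤ l⁻¹
  sub_eq : ∀ l m, 0 < l → 0 < m → R l - R m = (m - l) • (R l * R m)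
  eq_zero : ∀ l, 0 < l → ∀ a, R l * a = 0 → a = 0

namespace IsResolventFamily

variable {𝔸 : Type*} [NormedRing 𝔸] [NormedAlgebra ℝ 𝔸] {R : ℝ → 𝔸}

theorem commute (h : IsResolventFamily R) {l m : ℝ} (hl : 0 < l) (hm : 0 < m) :
    Commute (R l) (R m) := by
  rcases eq_or_ne l m with rfl | hne
  · exact Commute.refl _
  have h1 := h.sub_eq l m hl hm
  have h2 := h.sub_eq m l hm hl
  have h3 : (m - l) • (R l * R m) = (m - l) • (R m * R l) := by
    rw [← h1, ← neg_sub l m, neg_smul, ← h2, neg_sub]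
  exact smul_right_injective 𝔸 (sub_ne_zero.2 hne.symm) h3

theorem continuousAt (h : IsResolventFamily R) {l : ℝ} (hl : 0 < l) : ContinuousAt R l := by
  rw [ContinuousAt, tendsto_iff_norm_sub_tendsto_zero]
  have hlim : Tendsto (fun m : ℝ => |l - m| * ((l / 2)⁻¹ * l⁻¹)) (𝓝 l) (𝓝 0) := by
    have : Continuous (fun m : ℝ => |l - m| * ((l / 2)⁻¹ * l⁻¹)) := by fun_prop
    simpa using this.tendsto l
  refine squeeze_zero' (Eventually.of_forall fun _ => norm_nonneg _) ?_ hlim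
  filter_upwards [lt_mem_nhds (half_lt_self hl)] with m hm
  have hm0 : 0 < m := (half_pos hl).trans hm
  rw [h.sub_eq m l hm0 hl, norm_smul, Real.norm_eq_abs]
  gcongr
  calc ‖R m * R l‖ ≤ ‖R m‖ * ‖R l‖ := norm_mul_le _ _
    _ ≤ m⁻¹ * l⁻¹ := by
      gcongr
      · exact h.norm_le m hm0
      · exact h.norm_le l hl
    _ ≤ (l / 2)⁻¹ * l⁻¹ := by gcongr

theorem hasDerivAt (h : IsResolventFamily R) {l : ℝ} (hl : 0 < l) :
    HasDerivAt R (-(R l * R l)) l := by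
  rw [hasDerivAt_iff_tendsto_slope]
  have hlim : Tendsto (fun m => -(R m * R l)) (𝓝[≠] l) (𝓝 (-(R l * R l))) :=
    (((h.continuousAt hl).tendsto.mul_const _).neg).mono_left nhdsWithin_le_nhds
  refine hlim.congr' ?_
  have hpos : ∀ᶠ m in 𝓝[≠] l, 0 < m := nhdsWithin_le_nhds (lt_mem_nhds hl)
  filter_upwards [hpos, self_mem_nhdsWithin] with m hm hne
  have hne' : m - l ≠ 0 := sub_ne_zero.2 hne
  rw [slope_def_module, h.sub_eq m l hm hl, smul_smul, ← neg_sub m l, mul_neg,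
    inv_mul_cancel₀ hne', neg_one_smul]

theorem continuousOn_shift (h : IsResolventFamily R) {e : ℝ} (he : 0 ≤ e) :
    ContinuousOn (fun l => R (l + e)) (Set.Ioi 0) := by
  intro l hl
  have hl : 0 < l := hl
  have : ContinuousAt R (l + e) := h.continuousAt (by positivity)
  exact (ContinuousAt.comp (f := fun l : ℝ => l + e) this (by fun_prop)).continuousWithinAt

theorem norm_shift_le (h : IsResolventFamily R) {e : ℝ} (he : 0 ≤ e) (l : ℝ) (hl : 0 < l) :
    ‖R (l + e)‖ ≤ 1 * (l + e)⁻¹ := by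
  rw [one_mul]; exact h.norm_le _ (by positivity)

theorem integrableOn (h : IsResolventFamily R) {e : ℝ} (he : 0 < e) :
    IntegrableOn (fun l : ℝ => l ^ (-(1 / 2) : ℝ) • R (l + e)) (Set.Ioi 0) :=
  integrableOn_halfMean he (h.continuousOn_shift he.le) (h.norm_shift_le he.le)

end IsResolventFamily

/-- The inverse square root `(T + e) ^ (-1/2)` expressed through the resolvents
`R(λ) = (T + λ)⁻¹`. -/
def negHalf {X : Type*} [NormedAddCommGroup X] [NormedSpace ℝ X] (R : ℝ → X) (e : ℝ) : X :=
  halfMean fun l => R (l + e)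

/-- The bounded operator `D` with `(T + f) ^ (1/2) = (T + e) ^ (1/2) + D`, expressed through the
resolvents of `T`. -/
def sqrtDiff {𝔸 : Type*} [NormedRing 𝔸] [NormedAlgebra ℝ 𝔸] (R : ℝ → 𝔸) (e f : ℝ) : 𝔸 :=
  halfMean fun l => l • ((f - e) • (R (l + e) * R (l + f)))

namespace IsResolventFamily

variable {𝔸 : Type*} [NormedRing 𝔸] [NormedAlgebra ℝ 𝔸] {R : ℝ → 𝔸}

theorem norm_negHalf_le (h : IsResolventFamily R) {e : ℝ} (he : 0 < e) :
    ‖negHalf R e‖ ≤ (√e)⁻¹ := by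
  simpa only [negHalf, one_mul] using norm_halfMean_le he (h.norm_shift_le he.le)

theorem norm_sqrtDiff_integrand_le (h : IsResolventFamily R) {e f : ℝ} (he : 0 ≤ e)
    (hef : e ≤ f) (l : ℝ) (hl : 0 < l) :
    ‖l • ((f - e) • (R (l + e) * R (l + f)))‖ ≤ (f - e) * (l + f)⁻¹ := by
  have hfe : 0 ≤ f - e := sub_nonneg.2 hef
  have hf : 0 ≤ f := he.trans hef
  rw [norm_smul, norm_smul, Real.norm_of_nonneg hl.le, Real.norm_of_nonneg hfe]
  calc l * ((f - e) * ‖R (l + e) * R (l + f)‖)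
      ≤ l * ((f - e) * (l⁻¹ * (l + f)⁻¹)) := by
        gcongr
        refine (norm_mul_le _ _).trans ?_
        have h1 : ‖R (l + e)‖ ≤ l⁻¹ :=
          (h.norm_le _ (by positivity)).trans (by gcongr; linarith)
        have h2 : ‖R (l + f)‖ ≤ (l + f)⁻¹ := h.norm_le _ (by positivity)
        gcongr
    _ = (f - e) * (l + f)⁻¹ := by field_simp

theorem integrableOn_sqrtDiff (h : IsResolventFamily R) {e f : ℝ} (he : 0 ≤ e) (hf : 0 < f)
    (hef : e ≤ f) : IntegrableOn
      (fun l : ℝ => l ^ (-(1 / 2) : ℝ) • (l • ((f - e) • (R (l + e) * R (l + f)))))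
      (Set.Ioi 0) :=
  integrableOn_halfMean hf
    (continuousOn_id.smul (((h.continuousOn_shift he).mul
      (h.continuousOn_shift hf.le)).const_smul (f - e)))
    (h.norm_sqrtDiff_integrand_le he hef)

theorem norm_sqrtDiff_le (h : IsResolventFamily R) {e f : ℝ} (he : 0 ≤ e) (hf : 0 < f)
    (hef : e ≤ f) : ‖sqrtDiff R e f‖ ≤ (f - e) * (√f)⁻¹ :=
  norm_halfMean_le hf (h.norm_sqrtDiff_integrand_le he hef)

variable [CompleteSpace 𝔸]

theorem commute_negHalf (h : IsResolventFamily R) {e : ℝ} (he : 0 < e) {a : 𝔸}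
    (ha : ∀ l, 0 < l → Commute a (R l)) : Commute a (negHalf R e) := by
  have h1 := map_halfMean (ContinuousLinearMap.mul ℝ 𝔸 a) (h.integrableOn he)
  have h2 := map_halfMean ((ContinuousLinearMap.mul ℝ 𝔸).flip a) (h.integrableOn he)
  simp only [ContinuousLinearMap.flip_apply, ContinuousLinearMap.mul_apply'] at h1 h2
  rw [commute_iff_eq, negHalf, ← h1, ← h2]
  exact halfMean_congr fun l hl => (ha _ (by positivity)).eq

theorem commute_sqrtDiff (h : IsResolventFamily R) {e f : ℝ} (he : 0 ≤ e) (hf : 0 < f)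
    (hef : e ≤ f) {a : 𝔸} (ha : ∀ l, 0 < l → Commute a (R l)) :
    Commute a (sqrtDiff R e f) := by
  have h1 := map_halfMean (ContinuousLinearMap.mul ℝ 𝔸 a) (h.integrableOn_sqrtDiff he hf hef)
  have h2 := map_halfMean ((ContinuousLinearMap.mul ℝ 𝔸).flip a)
    (h.integrableOn_sqrtDiff he hf hef)
  simp only [ContinuousLinearMap.flip_apply, ContinuousLinearMap.mul_apply'] at h1 h2
  rw [commute_iff_eq, sqrtDiff, ← h1, ← h2]
  exact halfMean_congr fun l hl =>
    ((((ha _ (by positivity)).mul_right (ha _ (by positivity))).smul_right _).smul_right _).eq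

theorem resolvent_commute_negHalf (h : IsResolventFamily R) {l e : ℝ} (hl : 0 < l)
    (he : 0 < e) : Commute (R l) (negHalf R e) :=
  h.commute_negHalf he fun _ hm => h.commute hl hm

theorem negHalf_commute (h : IsResolventFamily R) {e f : ℝ} (he : 0 < e) (hf : 0 < f) :
    Commute (negHalf R e) (negHalf R f) :=
  h.commute_negHalf hf fun _ hm => (h.resolvent_commute_negHalf hm he).symm

end IsResolventFamily

/-! ### The inverse square root in a Banach algebra -/

namespace IsResolventFamily

variable {𝔸 : Type*} [NormedRing 𝔸] [NormedAlgebra ℝ 𝔸] {R : ℝ → 𝔸}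

theorem smul_mul_shift (h : IsResolventFamily R) {l e : ℝ} (hl : 0 < l) (he : 0 < e) :
    l • (R e * R (l + e)) = R e - R (l + e) := by
  rw [h.sub_eq e (l + e) he (by positivity), add_sub_cancel_right]

theorem norm_sq_le (h : IsResolventFamily R) {e : ℝ} (he : 0 < e) (l : ℝ) (hl : 0 < l) :
    ‖R (l + e) * R (l + e)‖ ≤ e⁻¹ * (l + e)⁻¹ := by
  refine (norm_mul_le _ _).trans ?_
  have h1 : ‖R (l + e)‖ ≤ (l + e)⁻¹ := h.norm_le _ (by positivity)
  have h2 : (l + e)⁻¹ ≤ e⁻¹ := by gcongr; linarith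
  have h3 : ‖R (l + e)‖ ≤ e⁻¹ := h1.trans h2
  gcongr

theorem integrableOn_sq (h : IsResolventFamily R) {e : ℝ} (he : 0 < e) :
    IntegrableOn (fun l : ℝ => l ^ (-(1 / 2) : ℝ) • (R (l + e) * R (l + e))) (Set.Ioi 0) :=
  integrableOn_halfMean he ((h.continuousOn_shift he.le).mul (h.continuousOn_shift he.le))
    (h.norm_sq_le he)

variable [CompleteSpace 𝔸]

/-- Integration by parts: the derivative of `√λ R(e) R(λ + e)` has integral zero. -/
theorem halfMean_sq (h : IsResolventFamily R) {e : ℝ} (he : 0 < e) :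
    halfMean (fun l => R (l + e) * R (l + e)) = (1 / 2 : ℝ) • (R e * negHalf R e) := by
  have hi1 := h.integrableOn_sq he
  have hi2 := (ContinuousLinearMap.mul ℝ 𝔸 (R e)).integrable_comp (h.integrableOn he)
  have hmap := map_halfMean (ContinuousLinearMap.mul ℝ 𝔸 (R e)) (h.integrableOn he)
  simp only [ContinuousLinearMap.mul_apply'] at hmap
  simp only [ContinuousLinearMap.mul_apply', mul_smul_comm] at hi2
  have hderiv : ∀ l ∈ Set.Ioi (0 : ℝ), HasDerivAt (fun l : ℝ => √l • (R e * R (l + e)))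
      (l ^ (-(1 / 2) : ℝ) • (R (l + e) * R (l + e)) -
        (1 / 2 : ℝ) • (l ^ (-(1 / 2) : ℝ) • (R e * R (l + e)))) l := by
    intro l hl
    have hl : 0 < l := hl
    have hR : HasDerivAt (fun l => R (l + e)) (-(R (l + e) * R (l + e))) l :=
      (h.hasDerivAt (l := l + e) (by positivity)).comp_add_const l e
    have hd := (Real.hasDerivAt_sqrt hl.ne').smul (hR.const_mul (R e))
    refine hd.congr_deriv ?_
    have hsl : 0 < √l := Real.sqrt_pos.2 hl
    have hkey : l • (R e * (R (l + e) * R (l + e))) =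
        R e * R (l + e) - R (l + e) * R (l + e) := by
      rw [← mul_assoc, ← smul_mul_assoc, h.smul_mul_shift hl he, sub_mul]
    have hsq : √l • (R e * (R (l + e) * R (l + e))) =
        (√l)⁻¹ • (R e * R (l + e) - R (l + e) * R (l + e)) := by
      rw [← hkey, smul_smul]
      congr 1
      rw [← div_eq_inv_mul, Real.div_sqrt]
    rw [rpow_neg_half_eq l hl.le, mul_neg, smul_neg, hsq, one_div, mul_inv, ← smul_smul,
      smul_sub]
    module
  have hcont : ContinuousWithinAt (fun l : ℝ => √l • (R e * R (l + e))) (Set.Ici 0) 0 := by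
    refine ContinuousAt.continuousWithinAt ?_
    have hR : ContinuousAt (fun l => R (l + e)) 0 :=
      ContinuousAt.comp (f := fun l : ℝ => l + e) (h.continuousAt (by simpa using he))
        (by fun_prop)
    exact Real.continuous_sqrt.continuousAt.smul (continuousAt_const.mul hR)
  have hlim : Tendsto (fun l : ℝ => √l • (R e * R (l + e))) atTop (𝓝 0) := by
    have hl0 : Tendsto (fun l : ℝ => e⁻¹ * (√l)⁻¹) atTop (𝓝 0) := by
      simpa using (tendsto_inv_atTop_zero.comp Real.tendsto_sqrt_atTop).const_mul e⁻¹
    refine squeeze_zero_norm' ?_ hl0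
    filter_upwards [eventually_gt_atTop 0] with l hl
    have hsl : 0 < √l := Real.sqrt_pos.2 hl
    rw [norm_smul, Real.norm_of_nonneg hsl.le]
    have h1 : ‖R e‖ ≤ e⁻¹ := h.norm_le e he
    have h2 : ‖R (l + e)‖ ≤ l⁻¹ :=
      (h.norm_le _ (by positivity)).trans (by gcongr; linarith)
    calc √l * ‖R e * R (l + e)‖ ≤ √l * (e⁻¹ * l⁻¹) := by
          gcongr; exact (norm_mul_le _ _).trans (by gcongr)
      _ = e⁻¹ * (√l)⁻¹ := by
          nth_rewrite 2 [← Real.mul_self_sqrt hl.le]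
          field_simp
  have hi3 : IntegrableOn
      (fun l : ℝ => (1 / 2 : ℝ) • (l ^ (-(1 / 2) : ℝ) • (R e * R (l + e)))) (Set.Ioi 0) :=
    hi2.smul (1 / 2 : ℝ)
  have hint := integral_Ioi_of_hasDerivAt_of_tendsto hcont hderiv (hi1.sub hi3) hlim
  rw [integral_sub hi1 hi3, integral_smul] at hint
  simp only [Real.sqrt_zero, zero_smul, sub_zero] at hint
  rw [negHalf, ← hmap, halfMean, halfMean, sub_eq_zero.1 hint, smul_comm]

theorem hasDerivAt_negHalf (h : IsResolventFamily R) {e : ℝ} (he : 0 < e) :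
    HasDerivAt (negHalf R) (-((1 / 2 : ℝ) • (R e * negHalf R e))) e := by
  have he2 : 0 < e / 2 := half_pos he
  have hs : Set.Ioi (e / 2) ∈ 𝓝 e := Ioi_mem_nhds (half_lt_self he)
  have hd := hasDerivAt_integral_of_dominated_loc_of_deriv_le
    (μ := volume.restrict (Set.Ioi (0 : ℝ)))
    (F := fun x l => l ^ (-(1 / 2) : ℝ) • R (l + x))
    (F' := fun x l => l ^ (-(1 / 2) : ℝ) • -(R (l + x) * R (l + x)))
    (bound := fun l => (e / 2)⁻¹ * (l ^ (-(1 / 2) : ℝ) * (l + e / 2)⁻¹)) (x₀ := e) hs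
    (by
      filter_upwards [lt_mem_nhds he] with x hx
      exact (h.integrableOn hx).aestronglyMeasurable)
    (h.integrableOn he)
    (by
      have := (h.integrableOn_sq he).aestronglyMeasurable.neg
      simp only [smul_neg]
      exact this)
    (by
      refine (ae_restrict_iff' measurableSet_Ioi).2 (Eventually.of_forall fun l hl x hx => ?_)
      have hl : 0 < l := hl
      have hx : e / 2 < x := hx
      have hx0 : 0 < x := he2.trans hx
      have hw : 0 ≤ l ^ (-(1 / 2) : ℝ) := by positivity
      rw [norm_smul, Real.norm_of_nonneg hw, norm_neg]
      calc l ^ (-(1 / 2) : ℝ) * ‖R (l + x) * R (l + x)‖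
          ≤ l ^ (-(1 / 2) : ℝ) * (x⁻¹ * (l + x)⁻¹) := by
            gcongr; exact h.norm_sq_le hx0 l hl
        _ ≤ l ^ (-(1 / 2) : ℝ) * ((e / 2)⁻¹ * (l + e / 2)⁻¹) := by gcongr
        _ = (e / 2)⁻¹ * (l ^ (-(1 / 2) : ℝ) * (l + e / 2)⁻¹) := by ring)
    ((integral_rpow_neg_half_mul_inv_add he2).1.const_mul _)
    (by
      refine (ae_restrict_iff' measurableSet_Ioi).2 (Eventually.of_forall fun l hl x hx => ?_)
      have hl : 0 < l := hl
      have hx0 : 0 < x := he2.trans hx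
      exact ((h.hasDerivAt (l := l + x) (by positivity)).comp_const_add l x).fun_const_smul _)
  have hd' := hd.2.const_smul Real.pi⁻¹
  refine hd'.congr_deriv ?_
  rw [← h.halfMean_sq he, halfMean]
  simp only [smul_neg, integral_neg]

/-- A quantitative form of `√e (T + e) ^ (-1/2) → I` on `dom T` as `e → ∞`. It follows from
`(λ + e) (T + λ + e)⁻¹ → I` because the weighted mean of `(λ + e)⁻¹` is `e ^ (-1/2)`. -/
theorem norm_sqrt_smul_negHalf_mul_sub_le (h : IsResolventFamily R) {e : ℝ} (he : 0 < e) :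
    ‖√e • (negHalf R e * R 1) - R 1‖ ≤ 2 * e⁻¹ := by
  have hse : 0 < √e := Real.sqrt_pos.2 he
  have h1 : ‖R 1‖ ≤ 1 := by simpa using h.norm_le 1 one_pos
  have hb : ∀ l, 0 < l → ‖R (l + e) * R 1 - (l + e)⁻¹ • R 1‖ ≤ (2 * e⁻¹) * (l + e)⁻¹ := by
    intro l hl
    have hs : 0 < l + e := by positivity
    have hid : R (l + e) * R 1 - (l + e)⁻¹ • R 1 =
        (l + e)⁻¹ • (R 1 * R (l + e) - R (l + e)) := by
      have h2 := h.sub_eq 1 (l + e) one_pos hs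
      rw [(h.commute hs one_pos).eq]
      have h3 : (l + e) • (R 1 * R (l + e)) - R 1 = R 1 * R (l + e) - R (l + e) := by
        rw [sub_smul, one_smul] at h2
        rw [sub_eq_sub_iff_add_eq_add] at h2 ⊢
        rw [← h2, add_comm]
      rw [← h3, smul_sub, smul_smul, inv_mul_cancel₀ hs.ne', one_smul]
    rw [hid, norm_smul, Real.norm_of_nonneg (inv_nonneg.2 hs.le)]
    have h4 : ‖R (l + e)‖ ≤ e⁻¹ := (h.norm_le _ hs).trans (by gcongr; linarith)
    have h5 : ‖R 1 * R (l + e) - R (l + e)‖ ≤ 2 * e⁻¹ :=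
      calc ‖R 1 * R (l + e) - R (l + e)‖ ≤ ‖R 1‖ * ‖R (l + e)‖ + ‖R (l + e)‖ :=
            (norm_sub_le _ _).trans (by gcongr; exact norm_mul_le _ _)
        _ ≤ 1 * e⁻¹ + e⁻¹ := by gcongr
        _ = 2 * e⁻¹ := by ring
    rw [mul_comm]
    gcongr
  have hle := norm_halfMean_le he hb
  have hi1 : IntegrableOn (fun l : ℝ => l ^ (-(1 / 2) : ℝ) • (R (l + e) * R 1)) (Set.Ioi 0) := by
    have := ((ContinuousLinearMap.mul ℝ 𝔸).flip (R 1)).integrable_comp (h.integrableOn he)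
    simp only [ContinuousLinearMap.flip_apply, ContinuousLinearMap.mul_apply',
      smul_mul_assoc] at this
    exact this
  have hi0 : IntegrableOn (fun l : ℝ => l ^ (-(1 / 2) : ℝ) • (l + e)⁻¹) (Set.Ioi 0) :=
    (integral_rpow_neg_half_mul_inv_add he).1
  have hi2 : IntegrableOn (fun l : ℝ => l ^ (-(1 / 2) : ℝ) • ((l + e)⁻¹ • R 1))
      (Set.Ioi 0) := by
    have := (ContinuousLinearMap.toSpanSingleton ℝ (R 1)).integrable_comp hi0
    simp only [ContinuousLinearMap.toSpanSingleton_apply, smul_assoc] at this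
    exact this
  have hm1 := map_halfMean ((ContinuousLinearMap.mul ℝ 𝔸).flip (R 1)) (h.integrableOn he)
  have hm2 := map_halfMean (ContinuousLinearMap.toSpanSingleton ℝ (R 1)) hi0
  simp only [ContinuousLinearMap.flip_apply, ContinuousLinearMap.mul_apply',
    ContinuousLinearMap.toSpanSingleton_apply] at hm1 hm2
  rw [halfMean_sub hi1 hi2, hm1, hm2, halfMean_inv_add he] at hle
  have hfin : √e • (negHalf R e * R 1) - R 1 =
      √e • (halfMean (fun l => R (l + e)) * R 1 - (√e)⁻¹ • R 1) := by
    rw [smul_sub, smul_smul, mul_inv_cancel₀ hse.ne', one_smul, negHalf]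
  rw [hfin, norm_smul, Real.norm_of_nonneg hse.le]
  calc √e * _ ≤ √e * (2 * e⁻¹ * (√e)⁻¹) := by gcongr
    _ = 2 * e⁻¹ := by field_simp

/-- The square of `(T + e) ^ (-1/2)` is `(T + e)⁻¹`. In terms of `J(e) = (T + e) ^ (-1/2)`, the
function `J(e) ^ 2 (T + e) (T + 1)⁻¹` of `e` has derivative zero and tends to `(T + 1)⁻¹` at
infinity. -/
theorem negHalf_mul_self (h : IsResolventFamily R) {e : ℝ} (he : 0 < e) :
    negHalf R e * negHalf R e = R e := by
  set J := negHalf R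
  -- `1 + (s - 1) R(1)` stands for `(T + s) (T + 1)⁻¹`.
  set G : ℝ → 𝔸 := fun s => J s * J s * (1 + (s - 1) • R 1) with hG
  have hone : ∀ s, 0 < s → R s * (1 + (s - 1) • R 1) = R 1 := by
    intro s hs
    rw [mul_add, mul_one, mul_smul_comm, (h.commute hs one_pos).eq, ← h.sub_eq 1 s one_pos hs]
    abel
  have hderiv : ∀ s, 0 < s → HasDerivAt G 0 s := by
    intro s hs
    have hJs := h.hasDerivAt_negHalf hs
    have hlin : HasDerivAt (fun s : ℝ => (1 : 𝔸) + (s - 1) • R 1) (R 1) s := by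
      simpa using (((hasDerivAt_id s).sub_const 1).smul_const (R 1)).const_add (1 : 𝔸)
    refine ((hJs.mul hJs).mul hlin).congr_deriv ?_
    have hc := (h.resolvent_commute_negHalf hs hs).eq
    have e1 : -((1 / 2 : ℝ) • (R s * J s)) * J s + J s * -((1 / 2 : ℝ) • (R s * J s)) =
        -(J s * J s * R s) := by
      have e2 : J s * (R s * J s) = J s * J s * R s := by rw [hc, mul_assoc]
      have e3 : R s * J s * J s = J s * J s * R s := by
        rw [hc, mul_assoc, hc, mul_assoc]
      rw [neg_mul, mul_neg, smul_mul_assoc, mul_smul_comm, e2, e3]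
      module
    change (-((1 / 2 : ℝ) • (R s * J s)) * J s + J s * -((1 / 2 : ℝ) • (R s * J s))) *
      (1 + (s - 1) • R 1) + J s * J s * R 1 = 0
    rw [e1, neg_mul, mul_assoc (J s * J s), hone s hs, neg_add_cancel]
  have hconst : ∀ s, 0 < s → G s = G e := by
    intro s hs
    refine isOpen_Ioi.is_const_of_deriv_eq_zero (s := Set.Ioi (0 : ℝ)) isPreconnected_Ioi
      (fun t ht => (hderiv t ht).differentiableAt.differentiableWithinAt)
      (fun t ht => (hderiv t ht).deriv) hs he
  have hbound : ∀ s, 0 < s → ‖G s - R 1‖ ≤ 6 * s⁻¹ := by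
    intro s hs
    have hss : 0 < √s := Real.sqrt_pos.2 hs
    have hR1 : ‖R 1‖ ≤ 1 := by simpa using h.norm_le 1 one_pos
    have hJn : ‖J s‖ ≤ (√s)⁻¹ := h.norm_negHalf_le hs
    have hsJ : ‖√s • J s‖ ≤ 1 := by
      rw [norm_smul, Real.norm_of_nonneg hss.le]
      calc √s * ‖J s‖ ≤ √s * (√s)⁻¹ := by gcongr
        _ = 1 := mul_inv_cancel₀ hss.ne'
    have hJJ : ‖J s * J s‖ ≤ s⁻¹ := by
      calc ‖J s * J s‖ ≤ (√s)⁻¹ * (√s)⁻¹ := (norm_mul_le _ _).trans (by gcongr)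
        _ = s⁻¹ := by rw [← mul_inv, Real.mul_self_sqrt hs.le]
    have hd := h.norm_sqrt_smul_negHalf_mul_sub_le hs
    have hs2 : s • (J s * J s * R 1) = (√s • J s) * (√s • (J s * R 1)) := by
      rw [smul_mul_smul_comm, Real.mul_self_sqrt hs.le, mul_assoc]
    have hsplit : G s - R 1 = J s * J s - J s * J s * R 1 +
        ((√s • J s) * (√s • (J s * R 1) - R 1) + (√s • (J s * R 1) - R 1)) := by
      simp only [hG]
      rw [mul_sub, ← hs2, smul_mul_assoc, mul_add, mul_one, mul_smul_comm]
      module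
    rw [hsplit]
    calc _ ≤ (‖J s * J s‖ + ‖J s * J s‖ * ‖R 1‖) +
          (‖√s • J s‖ * ‖√s • (J s * R 1) - R 1‖ + ‖√s • (J s * R 1) - R 1‖) := by
          refine (norm_add_le _ _).trans (add_le_add ?_ ?_)
          · exact (norm_sub_le _ _).trans (by gcongr; exact norm_mul_le _ _)
          · exact (norm_add_le _ _).trans (by gcongr; exact norm_mul_le _ _)
      _ ≤ (s⁻¹ + s⁻¹ * 1) + (1 * (2 * s⁻¹) + 2 * s⁻¹) := by gcongr
      _ = 6 * s⁻¹ := by ring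
  have hGe : G e = R 1 := by
    rw [← sub_eq_zero, ← norm_eq_zero]
    refine le_antisymm ?_ (norm_nonneg _)
    refine ge_of_tendsto (x := atTop) (f := fun s : ℝ => 6 * s⁻¹) ?_ ?_
    · simpa using tendsto_inv_atTop_zero.const_mul (6 : ℝ)
    · filter_upwards [eventually_gt_atTop 0] with s hs
      rw [← hconst s hs]; exact hbound s hs
  have hc1 := (h.resolvent_commute_negHalf one_pos he).eq
  have hone' : (1 + (e - 1) • R 1) * R e = R 1 := by
    rw [add_mul, one_mul, smul_mul_assoc, ← h.sub_eq 1 e one_pos he]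
    abel
  have hPR : J e * J e * R 1 = R 1 * R e := by
    rw [← hone', ← mul_assoc]
    change G e * R e = _
    rw [hGe, hone']
  have hGe' : J e * J e + (e - 1) • (J e * J e * R 1) = R 1 := by
    rw [← mul_smul_comm, ← mul_one_add (J e * J e)]
    exact hGe
  rw [hPR, ← h.sub_eq 1 e one_pos he] at hGe'
  exact add_right_cancel (b := R 1 - R e) (by rw [hGe']; abel)

theorem eq_zero_of_negHalf_mul (h : IsResolventFamily R) {e : ℝ} (he : 0 < e) {a : 𝔸}
    (ha : negHalf R e * a = 0) : a = 0 := by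
  refine h.eq_zero e he a ?_
  rw [← h.negHalf_mul_self he, mul_assoc, ha, mul_zero]

/-- The identity `(T + f) ^ (1/2) - (T + e) ^ (1/2) = D` in terms of bounded operators. -/
theorem negHalf_sub_negHalf (h : IsResolventFamily R) {e f : ℝ} (he : 0 < e) (hef : e ≤ f) :
    negHalf R e - negHalf R f = sqrtDiff R e f * (negHalf R e * negHalf R f) := by
  have hf : 0 < f := he.trans_le hef
  have hi := h.integrableOn_sqrtDiff he.le hf hef
  have hm1 := map_halfMean ((ContinuousLinearMap.mul ℝ 𝔸).flip (R e * R f)) hi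
  have hm2 := map_halfMean ((ContinuousLinearMap.mul ℝ 𝔸).flip (R e)) (h.integrableOn hf)
  have hm3 := map_halfMean ((ContinuousLinearMap.mul ℝ 𝔸).flip (R f)) (h.integrableOn he)
  have hi2 := ((ContinuousLinearMap.mul ℝ 𝔸).flip (R e)).integrable_comp (h.integrableOn hf)
  have hi3 := ((ContinuousLinearMap.mul ℝ 𝔸).flip (R f)).integrable_comp (h.integrableOn he)
  simp only [ContinuousLinearMap.flip_apply, ContinuousLinearMap.mul_apply',
    smul_mul_assoc] at hm1 hm2 hm3 hi2 hi3
  have hR : sqrtDiff R e f * (R e * R f) = negHalf R f * R e - negHalf R e * R f := by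
    rw [sqrtDiff, negHalf, negHalf, ← hm1, ← hm2, ← hm3, ← halfMean_sub hi2 hi3]
    refine halfMean_congr fun l hl => ?_
    have hle : 0 < l + e := by positivity
    have hlf : 0 < l + f := by positivity
    have h1 := h.sub_eq (l + e) (l + f) hle hlf
    rw [add_sub_add_left_eq_sub] at h1
    have h2 := h.smul_mul_shift hl he
    have h3 := h.smul_mul_shift hl hf
    rw [← smul_mul_assoc, ← h1, ← smul_mul_assoc]
    have e1 : R (l + e) * (R e * R f) = R e * R (l + e) * R f := by
      rw [← mul_assoc, (h.commute hle he).eq]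
    have e2 : R (l + f) * (R e * R f) = R f * R (l + f) * R e := by
      rw [(h.commute he hf).eq, ← mul_assoc, (h.commute hlf hf).eq]
    rw [smul_mul_assoc, sub_mul, e1, e2, smul_sub, ← smul_mul_assoc, h2, ← smul_mul_assoc, h3,
      sub_mul, sub_mul, (h.commute he hf).eq]
    abel
  have hcD : ∀ {s : ℝ}, 0 < s → Commute (sqrtDiff R e f) (R s) := fun {s} hs =>
    (h.commute_sqrtDiff he.le hf hef fun m hm => h.commute hs hm).symm
  have hcDe : Commute (sqrtDiff R e f) (negHalf R e) :=
    h.commute_negHalf he fun _ hm => hcD hm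
  have hcDf : Commute (sqrtDiff R e f) (negHalf R f) :=
    h.commute_negHalf hf fun _ hm => hcD hm
  have hc := (h.negHalf_commute he hf)
  rw [← h.negHalf_mul_self he, ← h.negHalf_mul_self hf] at hR
  generalize sqrtDiff R e f = D at *
  have hz : negHalf R f * (negHalf R e *
      (negHalf R e - negHalf R f - D * (negHalf R e * negHalf R f))) = 0 := by
    have e1 : negHalf R f * (negHalf R e * (D * (negHalf R e * negHalf R f))) =
        D * (negHalf R e * negHalf R e * (negHalf R f * negHalf R f)) := by
      rw [← mul_assoc (negHalf R e) D, ← hcDe.eq, mul_assoc D, ← mul_assoc (negHalf R f) D,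
        ← hcDf.eq, mul_assoc D]
      congr 1
      rw [← mul_assoc (negHalf R e) (negHalf R e), ← mul_assoc (negHalf R f),
        ← ((hc.mul_left hc).eq), mul_assoc]
    have e2 : negHalf R f * (negHalf R e * negHalf R f) =
        negHalf R e * (negHalf R f * negHalf R f) := by
      rw [← mul_assoc, ← hc.eq, mul_assoc]
    rw [mul_sub, mul_sub, mul_sub, mul_sub, e1, hR, e2]
    abel
  exact sub_eq_zero.1 (h.eq_zero_of_negHalf_mul he (h.eq_zero_of_negHalf_mul hf hz))

end IsResolventFamily

/-- The bounded operator `(T + e) ^ (1/2) (T + f) ^ (-1/2)`, expressed through the resolvents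
of `T`. -/
def sqrtRatio {𝔸 : Type*} [NormedRing 𝔸] [NormedAlgebra ℝ 𝔸] (R : ℝ → 𝔸) (e f : ℝ) : 𝔸 :=
  1 - sqrtDiff R e f * negHalf R f

namespace IsResolventFamily

variable {𝔸 : Type*} [NormedRing 𝔸] [NormedAlgebra ℝ 𝔸] {R : ℝ → 𝔸} [CompleteSpace 𝔸]

theorem commute_sqrtRatio (h : IsResolventFamily R) {e f : ℝ} (he : 0 < e) (hef : e ≤ f)
    {a : 𝔸} (ha : ∀ l, 0 < l → Commute a (R l)) : Commute a (sqrtRatio R e f) :=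
  (Commute.one_right a).sub_right ((h.commute_sqrtDiff he.le (he.trans_le hef) hef ha).mul_right
    (h.commute_negHalf (he.trans_le hef) ha))

theorem negHalf_commute_sqrtRatio (h : IsResolventFamily R) {s e f : ℝ} (hs : 0 < s)
    (he : 0 < e) (hef : e ≤ f) : Commute (negHalf R s) (sqrtRatio R e f) :=
  h.commute_sqrtRatio he hef fun _ hl => (h.resolvent_commute_negHalf hl hs).symm

theorem sqrtRatio_mul_negHalf (h : IsResolventFamily R) {e f : ℝ} (he : 0 < e) (hef : e ≤ f) :
    sqrtRatio R e f * negHalf R e = negHalf R f := by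
  rw [sqrtRatio, sub_mul, one_mul, mul_assoc, (h.negHalf_commute (he.trans_le hef) he).eq,
    ← h.negHalf_sub_negHalf he hef]
  abel

theorem negHalf_mul_sqrtRatio (h : IsResolventFamily R) {e f : ℝ} (he : 0 < e) (hef : e ≤ f) :
    negHalf R e * sqrtRatio R e f = negHalf R f := by
  rw [(h.negHalf_commute_sqrtRatio he he hef).eq, h.sqrtRatio_mul_negHalf he hef]

omit [CompleteSpace 𝔸] in
theorem norm_sqrtRatio_le (h : IsResolventFamily R) (h1 : ‖(1 : 𝔸)‖ ≤ 1) {e f : ℝ}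
    (he : 0 < e) (hef : e ≤ f) : ‖sqrtRatio R e f‖ ≤ 2 := by
  have hf : 0 < f := he.trans_le hef
  have hsf : 0 < √f := Real.sqrt_pos.2 hf
  have hfe : 0 ≤ f - e := sub_nonneg.2 hef
  calc ‖sqrtRatio R e f‖ ≤ ‖(1 : 𝔸)‖ + ‖sqrtDiff R e f‖ * ‖negHalf R f‖ :=
        (norm_sub_le _ _).trans (by gcongr; exact norm_mul_le _ _)
    _ ≤ 1 + ((f - e) * (√f)⁻¹) * (√f)⁻¹ := by
        gcongr
        · exact h.norm_sqrtDiff_le he.le hf hef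
        · exact h.norm_negHalf_le hf
    _ = 1 + (f - e) / f := by
        rw [mul_assoc, ← mul_inv, Real.mul_self_sqrt hf.le, div_eq_mul_inv]
    _ ≤ 2 := by
        have : (f - e) / f ≤ 1 := (div_le_one hf).2 (by linarith)
        linarith

theorem norm_sqrtRatio_sub_le (h : IsResolventFamily R) (h1 : ‖(1 : 𝔸)‖ ≤ 1) {e s t : ℝ}
    (he : 0 < e) (hes : e ≤ s) (hst : s ≤ t) :
    ‖sqrtRatio R e s - sqrtRatio R e t‖ ≤ 2 * e⁻¹ * (t - s) := by
  have hs : 0 < s := he.trans_le hes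
  have ht : 0 < t := hs.trans_le hst
  have hts : 0 ≤ t - s := sub_nonneg.2 hst
  have hid : sqrtRatio R e s - sqrtRatio R e t =
      sqrtDiff R s t * negHalf R s * sqrtRatio R e t := by
    rw [← sub_eq_zero]
    refine h.eq_zero_of_negHalf_mul he ?_
    have hc1 : Commute (negHalf R e) (sqrtDiff R s t * negHalf R s) :=
      (h.commute_sqrtDiff hs.le ht hst fun _ hl =>
        (h.resolvent_commute_negHalf hl he).symm).mul_right (h.negHalf_commute he hs)
    rw [mul_sub, mul_sub, h.negHalf_mul_sqrtRatio he hes,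
      h.negHalf_mul_sqrtRatio he (hes.trans hst), ← mul_assoc, hc1.eq, mul_assoc,
      h.negHalf_mul_sqrtRatio he (hes.trans hst), mul_assoc, ← h.negHalf_sub_negHalf hs hst,
      sub_self]
  rw [hid]
  have hse : 0 < √e := Real.sqrt_pos.2 he
  calc ‖sqrtDiff R s t * negHalf R s * sqrtRatio R e t‖
      ≤ ‖sqrtDiff R s t‖ * ‖negHalf R s‖ * ‖sqrtRatio R e t‖ :=
        (norm_mul_le _ _).trans (by gcongr; exact norm_mul_le _ _)
    _ ≤ ((t - s) * (√e)⁻¹) * (√e)⁻¹ * 2 := by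
        gcongr
        · refine (h.norm_sqrtDiff_le hs.le ht hst).trans ?_
          gcongr
          exact hes.trans hst
        · exact (h.norm_negHalf_le hs).trans (by gcongr)
        · exact h.norm_sqrtRatio_le h1 he (hes.trans hst)
    _ = 2 * e⁻¹ * (t - s) := by
        rw [mul_assoc (t - s), ← mul_inv, Real.mul_self_sqrt he.le]; ring

theorem continuousOn_sqrtRatio (h : IsResolventFamily R) (h1 : ‖(1 : 𝔸)‖ ≤ 1) {e : ℝ}
    (he : 0 < e) : ContinuousOn (sqrtRatio R e) (Set.Ici e) := by
  have hlip : LipschitzOnWith (2 * e⁻¹).toNNReal (sqrtRatio R e) (Set.Ici e) := by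
    refine LipschitzOnWith.of_dist_le_mul fun s hs t ht => ?_
    rw [Real.coe_toNNReal _ (by positivity), dist_eq_norm]
    rcases le_total s t with hst | hst
    · rw [dist_comm, Real.dist_eq, abs_of_nonneg (sub_nonneg.2 hst)]
      exact h.norm_sqrtRatio_sub_le h1 he hs hst
    · rw [norm_sub_rev, Real.dist_eq, abs_of_nonneg (sub_nonneg.2 hst)]
      exact h.norm_sqrtRatio_sub_le h1 he ht hst
  exact hlip.continuousOn

end IsResolventFamily

/-! ### Square roots of operators with contractive resolvents -/

section Resolvent

variable {E : Type*} [NormedAddCommGroup E] [InnerProductSpace ℂ E]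

theorem IsResolvent.eq {T : E →ₗ.[ℂ] E} {z : ℂ} {R R' : E →L[ℂ] E} (h : IsResolvent T z R)
    (h' : IsResolvent T z R') : R = R' := by
  ext y
  obtain ⟨hy, hy'⟩ := h'.1 y
  have := h.2 ⟨R' y, hy⟩
  rwa [hy'] at this

theorem IsResolvent.res_eq {T : E →ₗ.[ℂ] E} {z : ℂ} {R : E →L[ℂ] E} (h : IsResolvent T z R) :
    res T z = R := by
  have hex : ∃ R : E →L[ℂ] E, IsResolvent T z R := ⟨R, h⟩
  rw [res, dif_pos hex]
  exact hex.choose_spec.eq h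

theorem isResolvent_res {T : E →ₗ.[ℂ] E} {z : ℂ} (h : z ∈ resSet T) :
    IsResolvent T z (res T z) := by
  obtain ⟨R, hR⟩ := h
  rwa [hR.res_eq]

theorem IsResolvent.shift_of_sub {T : E →ₗ.[ℂ] E} {z c : ℂ} {R : E →L[ℂ] E}
    (h : IsResolvent T (z - c) R) : IsResolvent (shift T c) z R := by
  refine ⟨fun y => ?_, fun x => ?_⟩
  · obtain ⟨hy, hy'⟩ := h.1 y
    refine ⟨hy, ?_⟩
    refine Eq.trans ?_ hy'
    change c • R y + T ⟨R y, hy⟩ - z • R y = _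
    module
  · have h2 := h.2 x
    have he : shift T c x - z • (x : E) = T x - (z - c) • (x : E) := by
      change c • (x : E) + T x - z • (x : E) = _
      module
    exact (congrArg R he).trans h2

/-- The part of m-accretivity that concerns the half-line: `(T + λ)⁻¹` is bounded with norm at
most `1 / λ` for all `λ > 0`. -/
def HasContractiveResolvents (T : E →ₗ.[ℂ] E) : Prop :=
  ∀ l : ℝ, 0 < l → -(l : ℂ) ∈ resSet T ∧ ‖res T (-(l : ℂ))‖ ≤ l⁻¹

theorem IsMAccretive.hasContractiveResolvents {T : E →ₗ.[ℂ] E} (h : IsMAccretive T) :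
    HasContractiveResolvents T := fun l hl => by
  simpa using h (l : ℂ) (by simpa using hl)

/-- The resolvent `(T + λ)⁻¹` as a function of the real number `λ`. -/
def negRes (T : E →ₗ.[ℂ] E) (l : ℝ) : E →L[ℂ] E := res T (-(l : ℂ))

/-- The bounded operator `(T + e) ^ (-1/2)`. -/
abbrev negRoot (T : E →ₗ.[ℂ] E) (e : ℝ) : E →L[ℂ] E := negHalf (negRes T) e

namespace HasContractiveResolvents

variable {T : E →ₗ.[ℂ] E}

theorem mem_domain (h : HasContractiveResolvents T) {l : ℝ} (hl : 0 < l) (y : E) :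
    negRes T l y ∈ T.domain :=
  ((isResolvent_res (h l hl).1).1 y).1

theorem apply_negRes (h : HasContractiveResolvents T) {l : ℝ} (hl : 0 < l) (y : E) :
    T ⟨negRes T l y, h.mem_domain hl y⟩ + (l : ℂ) • negRes T l y = y := by
  obtain ⟨hy, hy'⟩ := (isResolvent_res (h l hl).1).1 y
  rw [neg_smul, sub_neg_eq_add] at hy'
  exact hy'

theorem negRes_apply (h : HasContractiveResolvents T) {l : ℝ} (hl : 0 < l) (x : T.domain) :
    negRes T l (T x + (l : ℂ) • (x : E)) = x := by
  have := (isResolvent_res (h l hl).1).2 x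
  rwa [neg_smul, sub_neg_eq_add] at this

theorem isResolventFamily (h : HasContractiveResolvents T) : IsResolventFamily (negRes T) where
  norm_le l hl := (h l hl).2
  sub_eq l m hl hm := by
    ext y
    have h1 := h.apply_negRes hm y
    have h2 := h.negRes_apply hl ⟨negRes T m y, h.mem_domain hm y⟩
    have h3 : y = (T ⟨negRes T m y, h.mem_domain hm y⟩ + (l : ℂ) • negRes T m y) +
        ((m - l : ℝ) : ℂ) • negRes T m y := by
      nth_rewrite 1 [← h1]
      push_cast
      module
    have h4 : negRes T l y = negRes T m y + ((m - l : ℝ) : ℂ) • negRes T l (negRes T m y) := by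
      nth_rewrite 1 [h3]
      rw [_root_.map_add, _root_.map_smul, h2]
    change negRes T l y - negRes T m y = (m - l) • negRes T l (negRes T m y)
    rw [h4, add_sub_cancel_left, Complex.coe_smul]
  eq_zero l hl a ha := by
    ext v
    have h0 : negRes T l (a v) = 0 := by
      have := congrArg (fun b : E →L[ℂ] E => b v) ha
      simpa using this
    have h1 := h.apply_negRes hl (a v)
    have h2 : T ⟨negRes T l (a v), h.mem_domain hl (a v)⟩ = 0 := by
      have h3 : (⟨negRes T l (a v), h.mem_domain hl (a v)⟩ : T.domain) = 0 := Subtype.ext h0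
      rw [h3, LinearPMap.map_zero]
    rw [h2, h0, smul_zero, add_zero] at h1
    simpa using h1.symm

theorem isResolvent_shift (h : HasContractiveResolvents T) {l e : ℝ} (hle : 0 < l + e) :
    IsResolvent (shift T e) (-(l : ℂ)) (negRes T (l + e)) := by
  apply IsResolvent.shift_of_sub
  have := isResolvent_res (h (l + e) hle).1
  rw [negRes]
  convert this using 1
  push_cast
  ring

end HasContractiveResolvents

end Resolvent

section BoundedPerturbation

variable {E F : Type*} [NormedAddCommGroup E] [InnerProductSpace ℂ E]
  [NormedAddCommGroup F] [InnerProductSpace ℂ F]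

theorem mem_graph_ofCLM {C : E →L[ℂ] F} {x : E} {y : F} :
    (x, y) ∈ (ofCLM C).graph ↔ C x = y := by
  rw [LinearPMap.mem_graph_iff]
  constructor
  · rintro ⟨u, hu, hu'⟩
    subst hu
    exact hu'
  · rintro rfl
    exact ⟨⟨x, Submodule.mem_top⟩, rfl, rfl⟩

theorem ofCLM_injective {C C' : E →L[ℂ] F} (h : ofCLM C = ofCLM C') : C = C' := by
  ext x
  have h1 : (x, C x) ∈ (ofCLM C').graph := h ▸ mem_graph_ofCLM.2 rfl
  exact (mem_graph_ofCLM.1 h1).symm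

theorem isClosed_ofCLM (C : E →L[ℂ] F) : (ofCLM C).IsClosed := by
  have h : ((ofCLM C).graph : Set (E × F)) = {p : E × F | C p.1 = p.2} := by
    ext ⟨x, y⟩
    exact mem_graph_ofCLM
  rw [LinearPMap.IsClosed, h]
  exact isClosed_eq (C.continuous.comp continuous_fst) continuous_snd

theorem ker_ofCLM {C : E →L[ℂ] F} (hC : Function.Injective C) :
    LinearMap.ker (ofCLM C).toFun = ⊥ := by
  refine LinearMap.ker_eq_bot'.2 fun x hx => ?_
  have h1 : C (x : E) = 0 := hx
  exact Subtype.ext (hC (h1.trans (map_zero C).symm))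

theorem mem_graph_inverse_ofCLM {C : E →L[ℂ] F} (hC : Function.Injective C) {x : F} {y : E} :
    (x, y) ∈ (ofCLM C).inverse.graph ↔ C y = x := by
  rw [LinearPMap.inverse_graph (ker_ofCLM hC)]
  constructor
  · rintro ⟨⟨a, b⟩, hab, he⟩
    obtain ⟨rfl, rfl⟩ := Prod.mk.inj he
    exact mem_graph_ofCLM.1 hab
  · intro h
    exact ⟨(y, x), mem_graph_ofCLM.2 h, rfl⟩

theorem inverse_inverse_ofCLM {C : E →L[ℂ] F} (hC : Function.Injective C) :
    (ofCLM C).inverse.inverse = ofCLM C := by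
  have hker : LinearMap.ker (ofCLM C).inverse.toFun = ⊥ := by
    refine LinearMap.ker_eq_bot'.2 fun x hx => ?_
    have h1 : ((x : F), (0 : E)) ∈ (ofCLM C).inverse.graph := by
      rw [← hx]; exact LinearPMap.mem_graph _ x
    rw [mem_graph_inverse_ofCLM hC, map_zero] at h1
    exact Subtype.ext h1.symm
  refine LinearPMap.eq_of_eq_graph ?_
  rw [LinearPMap.inverse_graph hker]
  ext ⟨x, y⟩
  constructor
  · rintro ⟨⟨a, b⟩, hab, he⟩
    obtain ⟨rfl, rfl⟩ := Prod.mk.inj he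
    exact mem_graph_ofCLM.2 ((mem_graph_inverse_ofCLM hC).1 hab)
  · intro h
    exact ⟨(y, x), (mem_graph_inverse_ofCLM hC).2 (mem_graph_ofCLM.1 h), rfl⟩

/-- If the graph of `f` is contained in the closed graph of `g` and dense in it, then `g` is the
closure of `f`. -/
theorem closure_eq_of_graph {f g : E →ₗ.[ℂ] F} (hg : g.IsClosed) (hfg : f ≤ g)
    (hd : (g.graph : Set (E × F)) ⊆ _root_.closure (f.graph : Set (E × F))) : f.closure = g := by
  have hcl : f.IsClosable := hg.isClosable.leIsClosable hfg
  refine LinearPMap.eq_of_eq_graph ?_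
  rw [← hcl.graph_closure_eq_closure_graph]
  refine SetLike.coe_injective ?_
  rw [Submodule.topologicalClosure_coe]
  exact Set.Subset.antisymm
    (closure_minimal (fun p hp => LinearPMap.le_graph_of_le hfg hp) hg) hd

theorem mem_domain_closure_iff {f : E →ₗ.[ℂ] F} (hf : f.IsClosable) {x : E} :
    x ∈ f.closure.domain ↔ ∃ y, (x, y) ∈ _root_.closure (f.graph : Set (E × F)) := by
  rw [LinearPMap.mem_domain_iff, ← hf.graph_closure_eq_closure_graph]
  rfl

/-- The closures of two operators that differ by a bounded operator have the same domain. -/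
theorem domain_closure_eq_of_bounded_diff {f g : E →ₗ.[ℂ] F} (D : E →L[ℂ] F)
    (hf : f.IsClosable) (hdom : g.domain = f.domain)
    (hval : ∀ (x : E) (hx : x ∈ f.domain) (hx' : x ∈ g.domain),
      f ⟨x, hx⟩ = g ⟨x, hx'⟩ + D x) : g.closure.domain = f.closure.domain := by
  let Φ : (E × F) ≃ₜ (E × F) :=
    { toFun := fun p => (p.1, p.2 + D p.1)
      invFun := fun p => (p.1, p.2 - D p.1)
      left_inv := fun p => by simp
      right_inv := fun p => by simp
      continuous_toFun := by fun_prop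
      continuous_invFun := by fun_prop }
  have hΦ : (g.graph : Set (E × F)) = Φ ⁻¹' (f.graph : Set (E × F)) := by
    ext ⟨x, y⟩
    change (x, y) ∈ g.graph ↔ (x, y + D x) ∈ f.graph
    rw [LinearPMap.mem_graph_iff, LinearPMap.mem_graph_iff]
    constructor
    · rintro ⟨⟨u, hu⟩, rfl, rfl⟩
      exact ⟨⟨u, hdom ▸ hu⟩, rfl, hval u (hdom ▸ hu) hu⟩
    · rintro ⟨⟨u, hu⟩, rfl, h⟩
      have hu' : u ∈ g.domain := hdom ▸ hu
      exact ⟨⟨u, hu'⟩, rfl, add_right_cancel ((hval u hu hu').symm.trans h)⟩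
  have hcl : ∀ x y, (x, y) ∈ _root_.closure (g.graph : Set (E × F)) ↔
      (x, y + D x) ∈ _root_.closure (f.graph : Set (E × F)) := by
    intro x y
    rw [hΦ, ← Φ.preimage_closure]
    rfl
  have hg : g.IsClosable := by
    refine ⟨g.graph.topologicalClosure.toLinearPMap,
      (Submodule.toLinearPMap_graph_eq _ ?_).symm⟩
    rintro ⟨x, y⟩ hxy hx
    have hx : x = 0 := hx
    subst hx
    have h1 := (hcl 0 y).1 hxy
    rw [map_zero, add_zero] at h1
    have h2 : ((0 : E), y) ∈ f.closure.graph := by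
      rw [← hf.graph_closure_eq_closure_graph]; exact h1
    exact LinearPMap.graph_fst_eq_zero_snd _ h2 rfl
  ext x
  rw [mem_domain_closure_iff hg, mem_domain_closure_iff hf]
  constructor
  · rintro ⟨y, hy⟩
    exact ⟨_, (hcl x y).1 hy⟩
  · rintro ⟨y, hy⟩
    exact ⟨y - D x, (hcl x _).2 (by rwa [sub_add_cancel])⟩

end BoundedPerturbation

section SquareRoot

variable {E : Type*} [NormedAddCommGroup E] [InnerProductSpace ℂ E] [CompleteSpace E]

theorem halfMean_apply {F : ℝ → E →L[ℂ] E}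
    (hF : IntegrableOn (fun l : ℝ => l ^ (-(1 / 2) : ℝ) • F l) (Set.Ioi 0)) (v : E) :
    IntegrableOn (fun l : ℝ => l ^ (-(1 / 2) : ℝ) • F l v) (Set.Ioi 0) ∧
      halfMean (fun l => F l v) = halfMean F v :=
  ⟨((ContinuousLinearMap.apply ℂ E v).restrictScalars ℝ).integrable_comp hF,
    map_halfMean ((ContinuousLinearMap.apply ℂ E v).restrictScalars ℝ) hF⟩

namespace HasContractiveResolvents

variable {T : E →ₗ.[ℂ] E}

/-- m-accretive operators are densely defined: if `x = (T + 1)⁻¹ u` with `u` orthogonal to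
`dom T`, then `Re ⟪T x, x⟫ = - ‖x‖ ^ 2`, while `T` is accretive. -/
theorem dense_domain (h : HasContractiveResolvents T) : Dense (T.domain : Set E) := by
  rw [Submodule.dense_iff_topologicalClosure_eq_top, Submodule.topologicalClosure_eq_top_iff,
    Submodule.eq_bot_iff]
  intro u hu
  set x := negRes T 1 u
  have hxd : x ∈ T.domain := h.mem_domain one_pos u
  have hux : inner ℂ u x = 0 := (Submodule.mem_orthogonal' _ _).1 hu x hxd
  have hTx : T ⟨x, hxd⟩ + x = u := by
    simpa using h.apply_negRes one_pos u
  have hle : ∀ l : ℝ, 0 < l → (2 * l - 1) * ‖x‖ ^ 2 ≤ ‖u‖ ^ 2 := by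
    intro l hl
    have h1 := h.negRes_apply hl ⟨x, hxd⟩
    have h2 : T ⟨x, hxd⟩ + (l : ℂ) • x = u + ((l - 1 : ℝ) : ℂ) • x := by
      rw [← hTx]; push_cast; module
    have h1' : negRes T l (u + ((l - 1 : ℝ) : ℂ) • x) = x := by rw [← h2]; exact h1
    have h3 : ‖x‖ ≤ l⁻¹ * ‖u + ((l - 1 : ℝ) : ℂ) • x‖ := by
      nth_rewrite 1 [← h1']
      exact (ContinuousLinearMap.le_opNorm _ _).trans (by gcongr; exact (h l hl).2)
    have h4 : l * ‖x‖ ≤ ‖u + ((l - 1 : ℝ) : ℂ) • x‖ := by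
      calc l * ‖x‖ ≤ l * (l⁻¹ * ‖u + ((l - 1 : ℝ) : ℂ) • x‖) := by gcongr
        _ = _ := by field_simp
    have h5 : ‖u + ((l - 1 : ℝ) : ℂ) • x‖ ^ 2 = ‖u‖ ^ 2 + (l - 1) ^ 2 * ‖x‖ ^ 2 := by
      rw [norm_add_sq (𝕜 := ℂ), inner_smul_right, hux, mul_zero, map_zero, mul_zero, add_zero,
        norm_smul, mul_pow, Complex.norm_real, Real.norm_eq_abs, sq_abs]
    have h6 : (l * ‖x‖) ^ 2 ≤ ‖u + ((l - 1 : ℝ) : ℂ) • x‖ ^ 2 :=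
      pow_le_pow_left₀ (by positivity) h4 2
    rw [h5] at h6
    nlinarith
  have hx0 : x = 0 := by
    by_contra hne
    have hp : 0 < ‖x‖ ^ 2 := by positivity
    have := hle ((‖u‖ ^ 2 / ‖x‖ ^ 2 + 2) / 2) (by positivity)
    have h7 : (2 * ((‖u‖ ^ 2 / ‖x‖ ^ 2 + 2) / 2) - 1) * ‖x‖ ^ 2 = ‖u‖ ^ 2 + ‖x‖ ^ 2 := by
      field_simp; ring
    linarith
  have h8 : T ⟨x, hxd⟩ = 0 := by
    have : (⟨x, hxd⟩ : T.domain) = 0 := Subtype.ext hx0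
    rw [this, LinearPMap.map_zero]
  rw [← hTx, h8, hx0, add_zero]

theorem negHalf_apply_negHalf (h : HasContractiveResolvents T) {e : ℝ} (he : 0 < e) (y : E) :
    negRoot T e (negRoot T e y) = negRes T e y :=
  congrArg (fun b : E →L[ℂ] E => b y) (h.isResolventFamily.negHalf_mul_self he)

theorem negHalf_injective (h : HasContractiveResolvents T) {e : ℝ} (he : 0 < e) :
    Function.Injective (negRoot T e) := by
  rw [injective_iff_map_eq_zero]
  intro y hy
  have h0 : negRes T e y = 0 := by rw [← h.negHalf_apply_negHalf he, hy, map_zero]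
  have h1 := h.apply_negRes he y
  have h2 : T ⟨negRes T e y, h.mem_domain he y⟩ = 0 := by
    have : (⟨negRes T e y, h.mem_domain he y⟩ : T.domain) = 0 := Subtype.ext h0
    rw [this, LinearPMap.map_zero]
  rw [h2, h0, smul_zero, add_zero] at h1
  exact h1.symm

theorem denseRange_negHalf (h : HasContractiveResolvents T) {e : ℝ} (he : 0 < e) :
    DenseRange (negRoot T e) := by
  refine h.dense_domain.mono fun x hx => ?_
  refine ⟨negHalf (negRes T) e (T ⟨x, hx⟩ + (e : ℂ) • x), ?_⟩
  rw [h.negHalf_apply_negHalf he]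
  exact h.negRes_apply he ⟨x, hx⟩

omit [CompleteSpace E] in
theorem sqrtIntegrand_shift (h : HasContractiveResolvents T) {e : ℝ} (he : 0 < e)
    (x : T.domain) (l : ℝ) (hl : 0 < l) : sqrtIntegrand (shift T e) x l =
      l ^ (-(1 / 2) : ℝ) • negRes T (l + e) (T x + (e : ℂ) • (x : E)) := by
  change l ^ (-(1 / 2) : ℝ) • res (shift T e) (-(l : ℂ)) ((e : ℂ) • (x : E) + T x) = _
  rw [(h.isResolvent_shift (by positivity)).res_eq, add_comm (T x)]

theorem integrableOn_sqrtIntegrand_shift (h : HasContractiveResolvents T) {e : ℝ} (he : 0 < e)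
    (x : T.domain) : IntegrableOn (sqrtIntegrand (shift T e) x) (Set.Ioi 0) :=
  (integrableOn_congr_fun (fun l hl => h.sqrtIntegrand_shift he x l hl) measurableSet_Ioi).2
    (halfMean_apply (h.isResolventFamily.integrableOn he) _).1

theorem mem_graph_balakrishnan_shift (h : HasContractiveResolvents T) {e : ℝ} (he : 0 < e)
    {x y : E} : (x, y) ∈ (balakrishnan (shift T e)).graph ↔
      ∃ hx : x ∈ T.domain, negRoot T e (T ⟨x, hx⟩ + (e : ℂ) • x) = y := by
  have hval : ∀ x : T.domain, (1 / Real.pi : ℝ) •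
      ∫ l in Set.Ioi (0 : ℝ), sqrtIntegrand (shift T e) x l =
        negRoot T e (T x + (e : ℂ) • (x : E)) := by
    intro x
    rw [negRoot, negHalf, ← (halfMean_apply (h.isResolventFamily.integrableOn he) _).2, halfMean,
      one_div, setIntegral_congr_fun measurableSet_Ioi
        (fun l hl => h.sqrtIntegrand_shift he x l hl)]
  rw [LinearPMap.mem_graph_iff]
  constructor
  · rintro ⟨⟨u, hu, hu'⟩, rfl, rfl⟩
    exact ⟨hu, (hval ⟨u, hu⟩).symm⟩
  · rintro ⟨hx, rfl⟩
    exact ⟨⟨x, hx, h.integrableOn_sqrtIntegrand_shift he ⟨x, hx⟩⟩, rfl, hval ⟨x, hx⟩⟩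

/-- On `dom T` the Balakrishnan operator of `S = T + e` is `J S` with `J = (T + e) ^ (-1/2)`, so its
graph consists of the pairs `(J w, w)` with `w` in the dense range of `J`, and its closure is the
inverse of `J`. -/
theorem sqrt_shift_eq (h : HasContractiveResolvents T) {e : ℝ} (he : 0 < e) :
    (balakrishnan (shift T e)).IsClosable ∧
      sqrt (shift T e) = (ofCLM (negRoot T e)).inverse := by
  have hinj := h.negHalf_injective he
  have hcl : (ofCLM (negRoot T e)).inverse.IsClosed :=
    (LinearPMap.inverse_closed_iff (ker_ofCLM hinj)).2 (isClosed_ofCLM _)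
  have hle : balakrishnan (shift T e) ≤ (ofCLM (negRoot T e)).inverse := by
    refine LinearPMap.le_of_le_graph ?_
    rintro ⟨x, y⟩ hxy
    obtain ⟨hx, rfl⟩ := (h.mem_graph_balakrishnan_shift he).1 hxy
    rw [mem_graph_inverse_ofCLM hinj, h.negHalf_apply_negHalf he]
    exact h.negRes_apply he ⟨x, hx⟩
  refine ⟨hcl.isClosable.leIsClosable hle, closure_eq_of_graph hcl hle ?_⟩
  rintro ⟨x, w⟩ hxw
  have hx : negRoot T e w = x := (mem_graph_inverse_ofCLM hinj).1 hxw
  subst hx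
  have hcont : Continuous fun w : E => (negRoot T e w, w) := by fun_prop
  have hmem : ∀ w ∈ Set.range (negRoot T e), (negRoot T e w, w) ∈
      ((balakrishnan (shift T e)).graph : Set (E × E)) := by
    rintro _ ⟨y, rfl⟩
    refine (h.mem_graph_balakrishnan_shift he).2 ?_
    rw [h.negHalf_apply_negHalf he]
    exact ⟨h.mem_domain he y, by rw [h.apply_negRes he]⟩
  exact map_mem_closure (f := fun w : E => (negRoot T e w, w)) hcont
    (h.denseRange_negHalf he w) hmem

theorem invSqrt_eq (h : HasContractiveResolvents T) {e : ℝ} (he : 0 < e) :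
    invSqrt T e = ofCLM (negRoot T e) := by
  rw [invSqrt, (h.sqrt_shift_eq he).2, inverse_inverse_ofCLM (h.negHalf_injective he)]

/-- The domain of the square root of `T` is the range of `(T + e) ^ (-1/2)`, for every `e > 0`. The
point is that the Balakrishnan operators of `T` and `T + e` differ by a bounded operator. -/
theorem sqrt_domain (h : HasContractiveResolvents T) {e : ℝ} (he : 0 < e) :
    ((sqrt T).domain : Set E) = Set.range (negRoot T e) := by
  have hfam := h.isResolventFamily
  have hdiff : ∀ (x : T.domain) (l : ℝ), 0 < l → sqrtIntegrand T x l =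
      sqrtIntegrand (shift T e) x l - l ^ (-(1 / 2) : ℝ) •
        (l • ((e - 0) • (negRes T (l + 0) * negRes T (l + e)))) (x : E) := by
    intro x l hl
    have hle : 0 < l + e := by positivity
    have h1 := h.negRes_apply hl x
    have h2 := h.negRes_apply hle x
    have h3 : negRes T l (x : E) - negRes T (l + e) (x : E) =
        (l + e - l) • negRes T l (negRes T (l + e) (x : E)) :=
      congrArg (fun b : E →L[ℂ] E => b (x : E)) (hfam.sub_eq l (l + e) hl hle)
    rw [h.sqrtIntegrand_shift he x l hl, sqrtIntegrand, ← smul_sub]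
    congr 1
    change negRes T l (T x) = negRes T (l + e) (T x + (e : ℂ) • (x : E)) -
      l • ((e - 0) • negRes T (l + 0) (negRes T (l + e) (x : E)))
    rw [add_sub_cancel_left] at h3
    rw [add_zero, sub_zero, ← h3]
    have h4 : negRes T l (T x) = (x : E) - (l : ℂ) • negRes T l (x : E) := by
      rw [eq_sub_iff_add_eq, ← _root_.map_smul, ← _root_.map_add, h1]
    have h5 : negRes T (l + e) (T x + (e : ℂ) • (x : E)) =
        (x : E) - (l : ℂ) • negRes T (l + e) (x : E) := by
      rw [eq_sub_iff_add_eq, ← _root_.map_smul, ← _root_.map_add, add_assoc, ← add_smul,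
        add_comm (e : ℂ), ← Complex.ofReal_add, h2]
    rw [h4, h5, smul_sub, Complex.coe_smul, Complex.coe_smul]
    abel
  have hD : ∀ x : E, _ := fun x =>
    halfMean_apply (hfam.integrableOn_sqrtDiff le_rfl he he.le) x
  have hint : ∀ x : T.domain, IntegrableOn (sqrtIntegrand T x) (Set.Ioi 0) := fun x =>
    (integrableOn_congr_fun (fun l hl => hdiff x l hl) measurableSet_Ioi).2
      ((h.integrableOn_sqrtIntegrand_shift he x).sub (hD (x : E)).1)
  have hval : ∀ x : T.domain, (1 / Real.pi : ℝ) • ∫ l in Set.Ioi (0 : ℝ),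
      sqrtIntegrand (shift T e) x l = (1 / Real.pi : ℝ) • (∫ l in Set.Ioi (0 : ℝ),
        sqrtIntegrand T x l) + sqrtDiff (negRes T) 0 e (x : E) := by
    intro x
    rw [setIntegral_congr_fun measurableSet_Ioi (fun l hl => hdiff x l hl),
      integral_sub (h.integrableOn_sqrtIntegrand_shift he x) (hD (x : E)).1, sqrtDiff,
      ← (hD (x : E)).2, halfMean, smul_sub, one_div, sub_add_cancel]
  have hdom := domain_closure_eq_of_bounded_diff (f := balakrishnan (shift T e))
    (g := balakrishnan T) (sqrtDiff (negRes T) 0 e) (h.sqrt_shift_eq he).1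
    (by
      ext x
      exact ⟨fun ⟨hx, _⟩ => ⟨hx, h.integrableOn_sqrtIntegrand_shift he ⟨x, hx⟩⟩,
        fun ⟨hx, _⟩ => ⟨hx, hint ⟨x, hx⟩⟩⟩)
    (fun x hx _ => hval ⟨x, hx.1⟩)
  have hdom' : (sqrt T).domain = (sqrt (shift T e)).domain := hdom
  rw [hdom', (h.sqrt_shift_eq he).2, LinearPMap.inverse_domain]
  ext x
  constructor
  · rintro ⟨u, rfl⟩
    exact ⟨u, rfl⟩
  · rintro ⟨u, rfl⟩
    exact ⟨⟨u, Submodule.mem_top⟩, rfl⟩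

end HasContractiveResolvents

end SquareRoot

/-! ### Adjoints, and products of bounded and unbounded factors -/

section Adjoint

variable {E : Type*} [NormedAddCommGroup E] [InnerProductSpace ℂ E] [CompleteSpace E]

/-- The adjoint on bounded operators as a real-linear map. -/
def adjointCLM : (E →L[ℂ] E) →L[ℝ] (E →L[ℂ] E) :=
  ((starL' ℝ : (E →L[ℂ] E) ≃L[ℝ] (E →L[ℂ] E)) : (E →L[ℂ] E) →L[ℝ] (E →L[ℂ] E))

theorem adjointCLM_apply (C : E →L[ℂ] E) : adjointCLM C = ContinuousLinearMap.adjoint C := rfl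

namespace HasContractiveResolvents

variable {T : E →ₗ.[ℂ] E}

theorem isResolvent_adjoint (h : HasContractiveResolvents T) {l : ℝ} (hl : 0 < l) :
    IsResolvent T.adjoint (-(l : ℂ)) (ContinuousLinearMap.adjoint (negRes T l)) := by
  have hT := h.dense_domain
  have hconj : starRingEnd ℂ (l : ℂ) = l := Complex.conj_ofReal l
  constructor
  · intro y
    have hx : ∀ x : T.domain,
        inner ℂ (y - (l : ℂ) • ContinuousLinearMap.adjoint (negRes T l) y) (x : E) =
          inner ℂ (ContinuousLinearMap.adjoint (negRes T l) y) (T x) := by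
      intro x
      have h1 := h.negRes_apply hl x
      rw [inner_sub_left, inner_smul_left, hconj, ContinuousLinearMap.adjoint_inner_left,
        ContinuousLinearMap.adjoint_inner_left, sub_eq_iff_eq_add, ← inner_smul_right,
        ← inner_add_right, ← _root_.map_smul, ← _root_.map_add, h1]
    have hmem : ContinuousLinearMap.adjoint (negRes T l) y ∈ T.adjoint.domain :=
      LinearPMap.mem_adjoint_domain_of_exists _ ⟨_, hx⟩
    refine ⟨hmem, ?_⟩
    rw [LinearPMap.adjoint_apply_eq hT ⟨_, hmem⟩ hx, neg_smul]
    abel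
  · intro x
    refine ext_inner_right ℂ fun u => ?_
    have h1 := LinearPMap.adjoint_isFormalAdjoint hT x ⟨negRes T l u, h.mem_domain hl u⟩
    rw [ContinuousLinearMap.adjoint_inner_left, neg_smul, sub_neg_eq_add, inner_add_left,
      inner_smul_left, hconj, h1, ← inner_smul_right, ← inner_add_right, h.apply_negRes hl u]

theorem negRes_adjoint (h : HasContractiveResolvents T) {l : ℝ} (hl : 0 < l) :
    negRes T.adjoint l = ContinuousLinearMap.adjoint (negRes T l) :=
  (h.isResolvent_adjoint hl).res_eq

theorem adjoint (h : HasContractiveResolvents T) : HasContractiveResolvents T.adjoint :=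
  fun l hl => ⟨⟨_, h.isResolvent_adjoint hl⟩, by
    rw [(h.isResolvent_adjoint hl).res_eq, LinearIsometryEquiv.norm_map]
    exact (h l hl).2⟩

theorem negRoot_adjoint (h : HasContractiveResolvents T) {e : ℝ} (he : 0 < e) :
    negRoot T.adjoint e = ContinuousLinearMap.adjoint (negRoot T e) := by
  have h1 := map_halfMean (adjointCLM (E := E)) (h.isResolventFamily.integrableOn he)
  rw [← adjointCLM_apply, negRoot, negRoot, negHalf, negHalf, ← h1]
  refine halfMean_congr fun l hl => ?_
  rw [h.negRes_adjoint (by positivity), adjointCLM_apply]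

end HasContractiveResolvents

end Adjoint

section UnboundedFactors

variable {E F G : Type*} [NormedAddCommGroup E] [InnerProductSpace ℂ E]
  [NormedAddCommGroup F] [InnerProductSpace ℂ F] [NormedAddCommGroup G] [InnerProductSpace ℂ G]

theorem mem_graph_pmul {g : F →ₗ.[ℂ] G} {f : E →ₗ.[ℂ] F} {x : E} {z : G} :
    (x, z) ∈ (pmul g f).graph ↔ ∃ y, (x, y) ∈ f.graph ∧ (y, z) ∈ g.graph := by
  simp only [LinearPMap.mem_graph_iff]
  constructor
  · rintro ⟨⟨u, hu, hu'⟩, rfl, rfl⟩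
    exact ⟨f ⟨u, hu⟩, ⟨⟨u, hu⟩, rfl, rfl⟩, ⟨_, hu'⟩, rfl, rfl⟩
  · rintro ⟨y, ⟨⟨u, hu⟩, rfl, rfl⟩, ⟨⟨v, hv⟩, hv', rfl⟩⟩
    have hv' : v = f ⟨u, hu⟩ := hv'
    subst hv'
    exact ⟨⟨u, hu, hv⟩, rfl, rfl⟩

theorem closure_eq_ofCLM {f : E →ₗ.[ℂ] F} {C : E →L[ℂ] F} (hf : f ≤ ofCLM C)
    (hd : Dense (f.domain : Set E)) : f.closure = ofCLM C := by
  refine closure_eq_of_graph (isClosed_ofCLM C) hf ?_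
  rintro ⟨x, y⟩ hxy
  have hy : C x = y := mem_graph_ofCLM.1 hxy
  subst hy
  have hcont : Continuous fun x : E => (x, C x) := by fun_prop
  refine map_mem_closure (f := fun x : E => (x, C x)) hcont (hd x) fun u hu => ?_
  have h1 := LinearPMap.le_graph_of_le hf (f.mem_graph ⟨u, hu⟩)
  change (u, C u) ∈ f.graph
  rw [mem_graph_ofCLM.1 h1]
  exact f.mem_graph ⟨u, hu⟩

theorem bddClosure_eq {f : E →ₗ.[ℂ] F} {C : E →L[ℂ] F} (hf : f ≤ ofCLM C)
    (hd : Dense (f.domain : Set E)) : bddClosure f = C := by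
  have h : ∃ C : E →L[ℂ] F, f.closure = ofCLM C := ⟨C, closure_eq_ofCLM hf hd⟩
  rw [bddClosure, dif_pos h]
  exact ofCLM_injective (h.choose_spec.symm.trans (closure_eq_ofCLM hf hd))

theorem bddClosure_ofCLM (C : E →L[ℂ] F) : bddClosure (ofCLM C) = C :=
  bddClosure_eq le_rfl (by
    have : ((ofCLM C).domain : Set E) = Set.univ := rfl
    rw [this]; exact dense_univ)

/-- By the closed graph theorem, `A J` is bounded if `A` is closed, `J` is bounded and the range
of `J` lies in the domain of `A`. -/
theorem exists_clm_of_range_subset_domain [CompleteSpace E] [CompleteSpace G] {A : F →ₗ.[ℂ] G}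
    (hA : A.IsClosed) (J : E →L[ℂ] F) (hJ : ∀ x, J x ∈ A.domain) :
    ∃ C : E →L[ℂ] G, ∀ x, (J x, C x) ∈ A.graph := by
  let C : E →ₗ[ℂ] G := A.toFun ∘ₗ (J : E →ₗ[ℂ] F).codRestrict A.domain hJ
  have hC : ∀ x, (J x, C x) ∈ A.graph := fun x => A.mem_graph ⟨J x, hJ x⟩
  have hgraph : (C.graph : Set (E × G)) =
      (fun p : E × G => (J p.1, p.2)) ⁻¹' (A.graph : Set (F × G)) := by
    ext ⟨x, y⟩
    constructor
    · intro h
      have h : y = C x := (LinearMap.mem_graph_iff _ _).1 h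
      subst h
      exact hC x
    · intro h
      exact (LinearMap.mem_graph_iff _ _).2 (A.mem_graph_snd_inj h (hC x) rfl)
  have hcl : _root_.IsClosed (C.graph : Set (E × G)) := by
    rw [hgraph]
    exact IsClosed.preimage (by fun_prop) hA
  exact ⟨⟨C, LinearMap.continuous_of_isClosed_graph C hcl⟩, hC⟩

theorem pmul_ofCLM_eq {A : F →ₗ.[ℂ] G} {J : E →L[ℂ] F} {C : E →L[ℂ] G}
    (h : ∀ x, (J x, C x) ∈ A.graph) : pmul A (ofCLM J) = ofCLM C := by
  refine LinearPMap.eq_of_eq_graph ?_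
  ext ⟨x, z⟩
  rw [mem_graph_pmul, mem_graph_ofCLM]
  constructor
  · rintro ⟨y, hy, hz⟩
    rw [mem_graph_ofCLM] at hy
    subst hy
    exact A.mem_graph_snd_inj (h x) hz rfl
  · rintro rfl
    exact ⟨J x, mem_graph_ofCLM.2 rfl, h x⟩

/-- The adjoint of a closed operator is densely defined. Mathlib's adjoint has the usual domain
even if `B` itself is not densely defined. -/
theorem dense_domain_adjoint [CompleteSpace E] [CompleteSpace F] {B : E →ₗ.[ℂ] F}
    (hB : B.IsClosed) : Dense (B.adjoint.domain : Set F) := by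
  rw [Submodule.dense_iff_topologicalClosure_eq_top, Submodule.topologicalClosure_eq_top_iff,
    Submodule.eq_bot_iff]
  intro u hu
  let S : Submodule ℂ (WithLp 2 (E × F)) :=
    B.graph.comap (WithLp.linearEquiv 2 ℂ (E × F) : WithLp 2 (E × F) →ₗ[ℂ] E × F)
  have hScl : _root_.IsClosed (S : Set (WithLp 2 (E × F))) :=
    IsClosed.preimage (WithLp.prod_continuous_ofLp 2 E F) hB
  have hmem : WithLp.toLp 2 ((0 : E), u) ∈ Sᗮᗮ := by
    rw [Submodule.mem_orthogonal]
    intro v hv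
    rw [Submodule.mem_orthogonal] at hv
    have hx : ∀ x : B.domain, inner ℂ (-v.fst) (x : E) = inner ℂ v.snd (B x) := by
      intro x
      have h1 := hv (WithLp.toLp 2 ((x : E), B x)) (B.mem_graph x)
      rw [WithLp.prod_inner_apply] at h1
      have h2 := congrArg (starRingEnd ℂ) h1
      simp only [map_add, inner_conj_symm, map_zero] at h2
      rw [inner_neg_left, neg_eq_iff_add_eq_zero]
      exact h2
    have hdom : v.snd ∈ B.adjoint.domain := LinearPMap.mem_adjoint_domain_of_exists _ ⟨_, hx⟩
    rw [WithLp.prod_inner_apply]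
    simpa using (Submodule.mem_orthogonal _ _).1 hu _ hdom
  rw [Submodule.orthogonal_orthogonal_eq_closure, hScl.submodule_topologicalClosure_eq] at hmem
  exact B.graph_fst_eq_zero_snd (x := 0) (x' := u) hmem rfl

/-- If `G = B J*` is bounded, then `J B*` is a restriction of the bounded operator `G*`. -/
theorem pmul_ofCLM_adjoint_le [CompleteSpace E] [CompleteSpace F] [CompleteSpace G]
    {B : E →ₗ.[ℂ] F} (hd : Dense (B.domain : Set E)) {J : E →L[ℂ] G} {C : G →L[ℂ] F}
    (h : ∀ x, (ContinuousLinearMap.adjoint J x, C x) ∈ B.graph) :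
    pmul (ofCLM J) B.adjoint ≤ ofCLM (ContinuousLinearMap.adjoint C) := by
  refine LinearPMap.le_of_le_graph ?_
  rintro ⟨x, z⟩ hxz
  obtain ⟨y, hxy, hyz⟩ := mem_graph_pmul.1 hxz
  rw [mem_graph_ofCLM] at hyz ⊢
  subst hyz
  refine ext_inner_right ℂ fun v => ?_
  obtain ⟨⟨x', hx'⟩, rfl, rfl⟩ := LinearPMap.mem_graph_iff _ |>.1 hxy
  obtain ⟨⟨w, hw⟩, hw1, hw2⟩ := LinearPMap.mem_graph_iff _ |>.1 (h v)
  have h1 := LinearPMap.adjoint_isFormalAdjoint hd ⟨x', hx'⟩ ⟨w, hw⟩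
  simp only at hw1 hw2
  rw [ContinuousLinearMap.adjoint_inner_left, ← hw2, ← h1,
    ← ContinuousLinearMap.adjoint_inner_right, ← hw1]

theorem domain_pmul_ofCLM {J : F →L[ℂ] G} {f : E →ₗ.[ℂ] F} :
    (pmul (ofCLM J) f).domain = f.domain := by
  ext x
  exact ⟨fun h => h.1, fun h => ⟨h, Submodule.mem_top⟩⟩

end UnboundedFactors

/-! ### Resolvents of the generalized sum -/

section Factors

variable {H K : Type*}
  [NormedAddCommGroup H] [InnerProductSpace ℂ H] [CompleteSpace H]
  [NormedAddCommGroup K] [InnerProductSpace ℂ K] [CompleteSpace K]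

/-- The bounded operator `A (T₀ + e) ^ (-1/2)`. -/
def rootA (T₀ : H →ₗ.[ℂ] H) (A : H →ₗ.[ℂ] K) (e : ℝ) : H →L[ℂ] K :=
  bddClosure (pmul A (invSqrt T₀ e))

/-- The bounded operator that is the closure of `(T₀ + e) ^ (-1/2) B*`. -/
def rootB (T₀ : H →ₗ.[ℂ] H) (B : H →ₗ.[ℂ] K) (e : ℝ) : K →L[ℂ] H :=
  bddClosure (pmul (invSqrt T₀ e) B.adjoint)

/-- The correction `cl((T₀ + e) ^ (-1/2) B*) (I - K(-e))⁻¹ A (T₀ + e) ^ (-1/2)`, which appears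
between two factors `(T₀ + e) ^ (-1/2)` in the formula for the resolvent of the sum. -/
def middle (T₀ : H →ₗ.[ℂ] H) (A B : H →ₗ.[ℂ] K) (e : ℝ) : H →L[ℂ] H :=
  rootB T₀ B e ∘L Ring.inverse (1 + rootA T₀ A e ∘L rootB T₀ B e) ∘L rootA T₀ A e

variable {T₀ : H →ₗ.[ℂ] H} {A B : H →ₗ.[ℂ] K}

theorem rootA_mem_graph (h0 : HasContractiveResolvents T₀) (hA : A.IsClosed)
    (hdA : (sqrt T₀).domain ≤ A.domain) {e : ℝ} (he : 0 < e) (x : H) :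
    (negRoot T₀ e x, rootA T₀ A e x) ∈ A.graph := by
  have hJ : ∀ x, negRoot T₀ e x ∈ A.domain := fun x => hdA (by
    have : negRoot T₀ e x ∈ ((sqrt T₀).domain : Set H) := by
      rw [h0.sqrt_domain he]; exact ⟨x, rfl⟩
    exact this)
  obtain ⟨C, hC⟩ := exists_clm_of_range_subset_domain hA (negRoot T₀ e) hJ
  have : rootA T₀ A e = C := by
    rw [rootA, h0.invSqrt_eq he, pmul_ofCLM_eq hC, bddClosure_ofCLM]
  rw [this]
  exact hC x

theorem rootB_apply (h0 : HasContractiveResolvents T₀) (hB : B.IsClosed)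
    (hBd : Dense (B.domain : Set H)) (hdB : (sqrt T₀.adjoint).domain ≤ B.domain)
    {e : ℝ} (he : 0 < e) {y : K} {w : H} (hyw : (y, w) ∈ B.adjoint.graph) :
    rootB T₀ B e y = negRoot T₀ e w := by
  have hJ : ∀ x, ContinuousLinearMap.adjoint (negRoot T₀ e) x ∈ B.domain := fun x => hdB (by
    have : ContinuousLinearMap.adjoint (negRoot T₀ e) x ∈ ((sqrt T₀.adjoint).domain : Set H) := by
      rw [h0.adjoint.sqrt_domain he, h0.negRoot_adjoint he]; exact ⟨x, rfl⟩
    exact this)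
  obtain ⟨C, hC⟩ := exists_clm_of_range_subset_domain hB _ hJ
  have hle := pmul_ofCLM_adjoint_le hBd hC
  have hBeq : rootB T₀ B e = ContinuousLinearMap.adjoint C := by
    rw [rootB, h0.invSqrt_eq he]
    exact bddClosure_eq hle (by rw [domain_pmul_ofCLM]; exact dense_domain_adjoint hB)
  rw [hBeq]
  exact mem_graph_ofCLM.1 (LinearPMap.le_graph_of_le hle
    (mem_graph_pmul.2 ⟨w, hyw, mem_graph_ofCLM.2 rfl⟩))

theorem eq_of_eqOn_adjoint_graph {G : Type*} [NormedAddCommGroup G] [InnerProductSpace ℂ G]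
    (hB : B.IsClosed) {C C' : K →L[ℂ] G}
    (h : ∀ y w, (y, w) ∈ B.adjoint.graph → C y = C' y) : C = C' := by
  refine ContinuousLinearMap.coeFn_injective
    (C.continuous.ext_on (dense_domain_adjoint hB) C'.continuous fun y hy => ?_)
  exact h y _ (B.adjoint.mem_graph ⟨y, hy⟩)

theorem rootA_eq_comp (h0 : HasContractiveResolvents T₀) (hA : A.IsClosed)
    (hdA : (sqrt T₀).domain ≤ A.domain) {e f : ℝ} (he : 0 < e) (hef : e ≤ f) :
    rootA T₀ A f = rootA T₀ A e ∘L sqrtRatio (negRes T₀) e f := by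
  ext x
  refine A.mem_graph_snd_inj (rootA_mem_graph h0 hA hdA (he.trans_le hef) x)
    (rootA_mem_graph h0 hA hdA he (sqrtRatio (negRes T₀) e f x)) ?_
  exact (congrArg (fun b : H →L[ℂ] H => b x)
    (h0.isResolventFamily.negHalf_mul_sqrtRatio he hef)).symm

theorem rootB_eq_comp (h0 : HasContractiveResolvents T₀) (hB : B.IsClosed)
    (hBd : Dense (B.domain : Set H)) (hdB : (sqrt T₀.adjoint).domain ≤ B.domain)
    {e f : ℝ} (he : 0 < e) (hef : e ≤ f) :
    rootB T₀ B f = sqrtRatio (negRes T₀) e f ∘L rootB T₀ B e := by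
  refine eq_of_eqOn_adjoint_graph hB fun y w hyw => ?_
  rw [ContinuousLinearMap.comp_apply, rootB_apply h0 hB hBd hdB (he.trans_le hef) hyw,
    rootB_apply h0 hB hBd hdB he hyw]
  exact (congrArg (fun b : H →L[ℂ] H => b w)
    (h0.isResolventFamily.sqrtRatio_mul_negHalf he hef)).symm

theorem opK_eq (h0 : HasContractiveResolvents T₀) (hA : A.IsClosed)
    (hdA : (sqrt T₀).domain ≤ A.domain) (hB : B.IsClosed) (hBd : Dense (B.domain : Set H))
    (hdB : (sqrt T₀.adjoint).domain ≤ B.domain) {e : ℝ} (he : 0 < e) :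
    opK T₀ A B (-(e : ℂ)) = -(rootA T₀ A e ∘L rootB T₀ B e) := by
  have hval : ∀ y w, (y, w) ∈ B.adjoint.graph →
      (negRes T₀ e w, rootA T₀ A e (rootB T₀ B e y)) ∈ A.graph := by
    intro y w hyw
    rw [rootB_apply h0 hB hBd hdB he hyw, ← h0.negHalf_apply_negHalf he]
    exact rootA_mem_graph h0 hA hdA he _
  refine bddClosure_eq (LinearPMap.le_of_le_graph ?_) ?_
  · rintro ⟨y, z⟩ hyz
    obtain ⟨⟨y', hy'⟩, rfl, rfl⟩ := (LinearPMap.mem_graph_iff _).1 hyz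
    have h1 := (pmul A (pmul (ofCLM (res T₀ (-(e : ℂ)))) B.adjoint)).mem_graph ⟨y', hy'⟩
    obtain ⟨x, hx, hxA⟩ := mem_graph_pmul.1 h1
    obtain ⟨w, hw, hwx⟩ := mem_graph_pmul.1 hx
    rw [mem_graph_ofCLM] at hwx ⊢
    subst hwx
    exact congrArg Neg.neg (A.mem_graph_snd_inj (hval y' w hw) hxA rfl)
  · refine (dense_domain_adjoint hB).mono fun y hy => ?_
    have h1 : (y, rootA T₀ A e (rootB T₀ B e y)) ∈
        (pmul A (pmul (ofCLM (res T₀ (-(e : ℂ)))) B.adjoint)).graph :=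
      mem_graph_pmul.2 ⟨_, mem_graph_pmul.2 ⟨_, B.adjoint.mem_graph ⟨y, hy⟩,
        mem_graph_ofCLM.2 rfl⟩, hval y _ (B.adjoint.mem_graph ⟨y, hy⟩)⟩
    have h2 : y ∈ (pmul A (pmul (ofCLM (res T₀ (-(e : ℂ)))) B.adjoint)).domain :=
      LinearPMap.mem_domain_of_mem_graph h1
    exact h2

theorem opR_eq (h0 : HasContractiveResolvents T₀) (hA : A.IsClosed)
    (hdA : (sqrt T₀).domain ≤ A.domain) (hB : B.IsClosed) (hBd : Dense (B.domain : Set H))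
    (hdB : (sqrt T₀.adjoint).domain ≤ B.domain) {e : ℝ} (he : 0 < e) :
    opR T₀ A B (-(e : ℂ)) =
      negRes T₀ e - negRoot T₀ e ∘L middle T₀ A B e ∘L negRoot T₀ e := by
  have h1 : bddClosure (pmul A (ofCLM (res T₀ (-(e : ℂ))))) = rootA T₀ A e ∘L negRoot T₀ e := by
    rw [pmul_ofCLM_eq (C := rootA T₀ A e ∘L negRoot T₀ e), bddClosure_ofCLM]
    intro x
    change (negRes T₀ e x, _) ∈ _
    rw [← h0.negHalf_apply_negHalf he]
    exact rootA_mem_graph h0 hA hdA he _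
  have h2 : bddClosure (pmul (ofCLM (res T₀ (-(e : ℂ)))) B.adjoint) =
      negRoot T₀ e ∘L rootB T₀ B e := by
    refine bddClosure_eq (LinearPMap.le_of_le_graph ?_)
      (by rw [domain_pmul_ofCLM]; exact dense_domain_adjoint hB)
    rintro ⟨y, x⟩ hyx
    obtain ⟨w, hw, hwx⟩ := mem_graph_pmul.1 hyx
    rw [mem_graph_ofCLM] at hwx ⊢
    subst hwx
    rw [ContinuousLinearMap.comp_apply, rootB_apply h0 hB hBd hdB he hw]
    exact h0.negHalf_apply_negHalf he w
  rw [opR, h1, h2, opK_eq h0 hA hdA hB hBd hdB he, sub_neg_eq_add]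
  rfl

theorem norm_one_clm_le (E : Type*) [NormedAddCommGroup E] [InnerProductSpace ℂ E] :
    ‖(1 : E →L[ℂ] E)‖ ≤ 1 :=
  ContinuousLinearMap.norm_id_le

theorem isUnit_one_add {E : Type*} [NormedAddCommGroup E] [InnerProductSpace ℂ E]
    [CompleteSpace E] {C : E →L[ℂ] E} (hC : ‖C‖ ≤ 1 / 2) : IsUnit (1 + C) := by
  have h : IsUnit (1 - -C) := isUnit_one_sub_of_norm_lt_one (by rw [norm_neg]; linarith)
  rwa [sub_neg_eq_add] at h

theorem norm_inverse_one_add_le {E : Type*} [NormedAddCommGroup E] [InnerProductSpace ℂ E]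
    [CompleteSpace E] {C : E →L[ℂ] E} (hC : ‖C‖ ≤ 1 / 2) : ‖Ring.inverse (1 + C)‖ ≤ 2 := by
  have h1 := Ring.mul_inverse_cancel _ (isUnit_one_add hC)
  set Y := Ring.inverse (1 + C)
  have h2 : Y = 1 - C * Y := by rw [eq_sub_iff_add_eq, ← h1, add_mul, one_mul]
  have h3 : ‖Y‖ ≤ 1 + 1 / 2 * ‖Y‖ := by
    nth_rewrite 1 [h2]
    refine (norm_sub_le _ _).trans (add_le_add (norm_one_clm_le E) ?_)
    exact (norm_mul_le _ _).trans (by gcongr)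
  linarith

omit [CompleteSpace K] in
theorem norm_rootA_comp_rootB_le {e : ℝ} (hν : normA T₀ A e * normB T₀ B e ≤ 1 / 2) :
    ‖rootA T₀ A e ∘L rootB T₀ B e‖ ≤ 1 / 2 :=
  (ContinuousLinearMap.opNorm_comp_le _ _).trans hν

theorem norm_middle_le {e : ℝ} (hν : normA T₀ A e * normB T₀ B e ≤ 1 / 2) :
    ‖middle T₀ A B e‖ ≤ 2 * (normA T₀ A e * normB T₀ B e) := by
  have h1 := norm_inverse_one_add_le (norm_rootA_comp_rootB_le hν)
  calc ‖middle T₀ A B e‖ ≤ ‖rootB T₀ B e‖ *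
        (‖Ring.inverse (1 + rootA T₀ A e ∘L rootB T₀ B e)‖ * ‖rootA T₀ A e‖) := by
        refine (ContinuousLinearMap.opNorm_comp_le _ _).trans ?_
        gcongr
        exact ContinuousLinearMap.opNorm_comp_le _ _
    _ ≤ ‖rootB T₀ B e‖ * (2 * ‖rootA T₀ A e‖) := by gcongr
    _ = 2 * (normA T₀ A e * normB T₀ B e) := by
        rw [normA, normB, rootA, rootB]; ring

theorem admissible_of_norm_le (h0 : HasContractiveResolvents T₀) (hA : A.IsClosed)
    (hdA : (sqrt T₀).domain ≤ A.domain) (hB : B.IsClosed) (hBd : Dense (B.domain : Set H))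
    (hdB : (sqrt T₀.adjoint).domain ≤ B.domain) {e : ℝ} (he : 0 < e)
    (hν : normA T₀ A e * normB T₀ B e ≤ 1 / 2) : -(e : ℂ) ∈ admissible T₀ A B := by
  refine ⟨(h0 e he).1, ?_⟩
  rw [spectrum.mem_resolventSet_iff, map_one, opK_eq h0 hA hdA hB hBd hdB he, sub_neg_eq_add]
  exact isUnit_one_add (norm_rootA_comp_rootB_le hν)

/-- `R(-e)` is injective: if `R(-e) y = 0`, then `w = A (T₀ + e)⁻¹ y` satisfies
`(I - K)⁻¹ w = w + K (I - K)⁻¹ w = 0` with `K = K(-e)`. -/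
theorem opR_injective (h0 : HasContractiveResolvents T₀) (hA : A.IsClosed)
    (hdA : (sqrt T₀).domain ≤ A.domain) (hB : B.IsClosed) (hBd : Dense (B.domain : Set H))
    (hdB : (sqrt T₀.adjoint).domain ≤ B.domain) {e : ℝ} (he : 0 < e)
    (hν : normA T₀ A e * normB T₀ B e ≤ 1 / 2) {y : H}
    (hy : opR T₀ A B (-(e : ℂ)) y = 0) : y = 0 := by
  rw [opR_eq h0 hA hdA hB hBd hdB he] at hy
  have hinj := h0.negHalf_injective he
  set J := negRoot T₀ e
  set P := rootA T₀ A e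
  set Q := rootB T₀ B e
  set Y := Ring.inverse (1 + P ∘L Q)
  have hu := isUnit_one_add (norm_rootA_comp_rootB_le hν)
  have hy1 : J (J y - Q (Y (P (J y)))) = 0 := by
    rw [map_sub, h0.negHalf_apply_negHalf he]
    exact hy
  have hy2 : J y = Q (Y (P (J y))) :=
    sub_eq_zero.1 (hinj (hy1.trans (map_zero _).symm))
  have h1 : ∀ v, Y v + P (Q (Y v)) = v := fun v =>
    congrArg (fun b : K →L[ℂ] K => b v) (Ring.mul_inverse_cancel _ hu)
  have h2 := h1 (P (J y))
  rw [← hy2] at h2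
  have h3 : Y (P (J y)) = 0 := by simpa using h2
  rw [h3, map_zero] at hy2
  exact hinj (hy2.trans (map_zero _).symm)

/-- The resolvent of the generalized sum at `-e` is `R(-e)`. The bounded inverse of `T + e` exists by
assumption; once the graph defining `T` is known to be single-valued, the defining equation at the
admissible point `-e` identifies it with `R(-e)`. -/
theorem negRes_genSum (h0 : HasContractiveResolvents T₀) (hA : A.IsClosed)
    (hdA : (sqrt T₀).domain ≤ A.domain) (hB : B.IsClosed) (hBd : Dense (B.domain : Set H))
    (hdB : (sqrt T₀.adjoint).domain ≤ B.domain)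
    (hT : HasContractiveResolvents (genSum T₀ A B)) {e : ℝ} (he : 0 < e)
    (hν : normA T₀ A e * normB T₀ B e ≤ 1 / 2) :
    negRes (genSum T₀ A B) e =
      negRes T₀ e - negRoot T₀ e * middle T₀ A B e * negRoot T₀ e := by
  have hadm := admissible_of_norm_le h0 hA hdA hB hBd hdB he hν
  have hsv : ∀ p ∈ sumGraph T₀ A B, p.1 = 0 → p.2 = 0 := by
    rintro ⟨x, y⟩ hp hx
    have hx : x = 0 := hx
    subst hx
    have h1 := hp _ hadm
    simp only [smul_zero, sub_zero] at h1
    exact opR_injective h0 hA hdA hB hBd hdB he hν h1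
  have heq : negRes (genSum T₀ A B) e = opR T₀ A B (-(e : ℂ)) := by
    ext u
    have h1 := hT.apply_negRes he u
    have hm : (negRes (genSum T₀ A B) e u, genSum T₀ A B ⟨_, hT.mem_domain he u⟩) ∈
        (sumGraph T₀ A B).toLinearPMap.graph :=
      (genSum T₀ A B).mem_graph ⟨_, hT.mem_domain he u⟩
    rw [Submodule.toLinearPMap_graph_eq _ hsv] at hm
    have h2 := hm _ hadm
    rw [neg_smul, sub_neg_eq_add] at h2
    exact h2.symm.trans (congrArg _ h1)
  rw [heq, opR_eq h0 hA hdA hB hBd hdB he, mul_assoc]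
  rfl

end Factors

/-! ### Comparison of the square roots -/

section Estimate

variable {X : Type*} [NormedAddCommGroup X] [NormedSpace ℝ X]

/-- The weighted mean of a function bounded by `4 ν(λ) (λ + E) ^ (-1/2)`. On `(0, r]` the function
`ν` is estimated by its supremum, on `(r, ∞)` the two square roots combine to `1 / λ`. -/
theorem halfMean_estimate {F : ℝ → X} {ν : ℝ → ℝ} {r E ε : ℝ} (hr : 0 < r) (hrE : r ≤ E)
    (hF : ContinuousOn F (Set.Ioi 0)) (hν0 : ∀ l, 0 < l → 0 ≤ ν l)
    (hνε : ∀ l, 0 < l → ν l ≤ ε)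
    (hb : ∀ l, 0 < l → ‖F l‖ ≤ 4 * ν l * (√(l + E))⁻¹)
    (hint : IntegrableOn (fun l => l⁻¹ * ν l) (Set.Ioi r))
    (hle : ∫ l in Set.Ioi r, l⁻¹ * ν l ≤ ε) :
    IntegrableOn (fun l : ℝ => l ^ (-(1 / 2) : ℝ) • F l) (Set.Ioi 0) ∧
      ‖halfMean F‖ ≤ 12 * ε := by
  have hE : 0 < E := hr.trans_le hrE
  have hε : 0 ≤ ε := (hν0 1 one_pos).trans (hνε 1 one_pos)
  have hsr : 0 < √r := Real.sqrt_pos.2 hr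
  have hmeas : AEStronglyMeasurable (fun l : ℝ => l ^ (-(1 / 2) : ℝ) • F l)
      (volume.restrict (Set.Ioi 0)) :=
    (continuousOn_rpow_neg_half.smul hF).aestronglyMeasurable measurableSet_Ioi
  have hnorm : ∀ l : ℝ, 0 < l →
      ‖l ^ (-(1 / 2) : ℝ) • F l‖ ≤ (√l)⁻¹ * (4 * ν l * (√(l + E))⁻¹) := by
    intro l hl
    rw [norm_smul, rpow_neg_half_eq l hl.le,
      Real.norm_of_nonneg (inv_nonneg.2 (Real.sqrt_nonneg l))]
    gcongr
    exact hb l hl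
  have hnorm1 : ∀ l ∈ Set.Ioc 0 r,
      ‖l ^ (-(1 / 2) : ℝ) • F l‖ ≤ (4 * ε * (√r)⁻¹) * l ^ (-(1 / 2) : ℝ) := by
    intro l hl
    refine (hnorm l hl.1).trans ?_
    rw [rpow_neg_half_eq l hl.1.le, mul_comm (√l)⁻¹]
    have h1 : ν l ≤ ε := hνε l hl.1
    have h2 : r ≤ l + E := by linarith [hl.1]
    gcongr
  have hnorm2 : ∀ l ∈ Set.Ioi r, ‖l ^ (-(1 / 2) : ℝ) • F l‖ ≤ 4 * (l⁻¹ * ν l) := by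
    intro l hl
    have hl0 : 0 < l := hr.trans hl
    have hsl : 0 < √l := Real.sqrt_pos.2 hl0
    have h1 := hν0 l hl0
    have h2 : (√(l + E))⁻¹ ≤ (√l)⁻¹ := by gcongr; linarith
    calc ‖l ^ (-(1 / 2) : ℝ) • F l‖ ≤ (√l)⁻¹ * (4 * ν l * (√(l + E))⁻¹) := hnorm l hl0
      _ ≤ (√l)⁻¹ * (4 * ν l * (√l)⁻¹) := by gcongr
      _ = 4 * (((√l)⁻¹ * (√l)⁻¹) * ν l) := by ring
      _ = 4 * (l⁻¹ * ν l) := by rw [← mul_inv, Real.mul_self_sqrt hl0.le]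
  have hpow : IntegrableOn (fun l : ℝ => l ^ (-(1 / 2) : ℝ)) (Set.Ioc 0 r) := by
    have h := intervalIntegral.intervalIntegrable_rpow' (a := 0) (b := r) (r := -(1 / 2))
      (by norm_num)
    exact (intervalIntegrable_iff_integrableOn_Ioc_of_le hr.le).1 h
  have hpowint : ∫ l in Set.Ioc 0 r, l ^ (-(1 / 2) : ℝ) = 2 * √r := by
    rw [← intervalIntegral.integral_of_le hr.le, integral_rpow (Or.inl (by norm_num)),
      Real.sqrt_eq_rpow, Real.zero_rpow (by norm_num)]
    norm_num
    ring
  have hi1 : IntegrableOn (fun l : ℝ => l ^ (-(1 / 2) : ℝ) • F l) (Set.Ioc 0 r) :=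
    (hpow.const_mul _).mono' (hmeas.mono_set Set.Ioc_subset_Ioi_self)
      ((ae_restrict_iff' measurableSet_Ioc).2 (Eventually.of_forall hnorm1))
  have hi2 : IntegrableOn (fun l : ℝ => l ^ (-(1 / 2) : ℝ) • F l) (Set.Ioi r) :=
    (hint.const_mul 4).mono' (hmeas.mono_set (Set.Ioi_subset_Ioi hr.le))
      ((ae_restrict_iff' measurableSet_Ioi).2 (Eventually.of_forall hnorm2))
  have hunion : Set.Ioc 0 r ∪ Set.Ioi r = Set.Ioi (0 : ℝ) := Set.Ioc_union_Ioi_eq_Ioi hr.le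
  refine ⟨hunion ▸ hi1.union hi2, ?_⟩
  have hb1 : ‖∫ l in Set.Ioc 0 r, l ^ (-(1 / 2) : ℝ) • F l‖ ≤ 8 * ε := by
    refine (norm_integral_le_of_norm_le (hpow.const_mul _)
      ((ae_restrict_iff' measurableSet_Ioc).2 (Eventually.of_forall hnorm1))).trans ?_
    rw [integral_const_mul, hpowint]
    refine le_of_eq ?_
    field_simp
    ring
  have hb2 : ‖∫ l in Set.Ioi r, l ^ (-(1 / 2) : ℝ) • F l‖ ≤ 4 * ε := by
    refine (norm_integral_le_of_norm_le (hint.const_mul 4)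
      ((ae_restrict_iff' measurableSet_Ioi).2 (Eventually.of_forall hnorm2))).trans ?_
    rw [integral_const_mul]
    gcongr
  rw [halfMean, norm_smul, Real.norm_of_nonneg (inv_nonneg.2 Real.pi_pos.le), ← hunion,
    setIntegral_union (Set.Ioc_disjoint_Ioi le_rfl) measurableSet_Ioi hi1 hi2]
  have hpi : Real.pi⁻¹ ≤ 1 := inv_le_one_of_one_le₀ (by linarith [Real.pi_gt_three])
  calc Real.pi⁻¹ * _ ≤ 1 * (8 * ε + 4 * ε) := by
        gcongr
        exact (norm_add_le _ _).trans (add_le_add hb1 hb2)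
    _ = 12 * ε := by ring

theorem range_mul_one_sub {E : Type*} [NormedAddCommGroup E] [InnerProductSpace ℂ E]
    [CompleteSpace E] (J : E →L[ℂ] E) {S : E →L[ℂ] E} (hS : ‖S‖ < 1) :
    Set.range (J * (1 - S) : E →L[ℂ] E) = Set.range J := by
  have hu := Ring.mul_inverse_cancel _ (isUnit_one_sub_of_norm_lt_one hS)
  ext x
  constructor
  · rintro ⟨y, rfl⟩
    exact ⟨(1 - S) y, rfl⟩
  · rintro ⟨y, rfl⟩
    refine ⟨Ring.inverse (1 - S) y, ?_⟩
    exact congrArg (fun b : E →L[ℂ] E => J (b y)) hu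

end Estimate

section Main

variable {H K : Type*}
  [NormedAddCommGroup H] [InnerProductSpace ℂ H] [CompleteSpace H]
  [NormedAddCommGroup K] [InnerProductSpace ℂ K] [CompleteSpace K]
  {T₀ : H →ₗ.[ℂ] H} {A B : H →ₗ.[ℂ] K}

/-- The factors `A (T₀ + s) ^ (-1/2)` and `cl((T₀ + s) ^ (-1/2) B*)` depend continuously on `s`
because they are the ones at `E` multiplied by `(T₀ + E) ^ (1/2) (T₀ + s) ^ (-1/2)`. -/
theorem continuousOn_middle (h0 : HasContractiveResolvents T₀) (hA : A.IsClosed)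
    (hdA : (sqrt T₀).domain ≤ A.domain) (hB : B.IsClosed) (hBd : Dense (B.domain : Set H))
    (hdB : (sqrt T₀.adjoint).domain ≤ B.domain) {E : ℝ} (hE : 0 < E)
    (hν : ∀ s, E ≤ s → normA T₀ A s * normB T₀ B s ≤ 1 / 2) :
    ContinuousOn (middle T₀ A B) (Set.Ici E) := by
  have hM := h0.isResolventFamily.continuousOn_sqrtRatio (norm_one_clm_le H) hE
  have hcA : ContinuousOn (rootA T₀ A) (Set.Ici E) :=
    (continuousOn_const.clm_comp hM).congr fun s hs => rootA_eq_comp h0 hA hdA hE hs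
  have hcB : ContinuousOn (rootB T₀ B) (Set.Ici E) :=
    (hM.clm_comp continuousOn_const).congr fun s hs => rootB_eq_comp h0 hB hBd hdB hE hs
  have hcI : ContinuousOn (fun s => Ring.inverse (1 + rootA T₀ A s ∘L rootB T₀ B s))
      (Set.Ici E) := by
    intro s hs
    have hu := isUnit_one_add (norm_rootA_comp_rootB_le (hν s hs))
    have h1 := NormedRing.inverse_continuousAt hu.unit
    rw [IsUnit.unit_spec] at h1
    exact ContinuousAt.comp_continuousWithinAt
      (f := fun s => 1 + rootA T₀ A s ∘L rootB T₀ B s) h1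
      ((continuousOn_const.add (hcA.clm_comp hcB)) s hs)
  exact hcB.clm_comp (hcI.clm_comp hcA)

/-- For large `E`, the operator `(T + E) ^ (-1/2)` is obtained from `(T₀ + E) ^ (-1/2)` by
multiplication with an invertible operator from the right as well as from the left. -/
theorem exists_negRoot_genSum_eq (hsum : SumHyp T₀ A B) (hsqrt : SqrtHyp T₀ A B)
    (hT : HasContractiveResolvents (genSum T₀ A B)) :
    ∃ E > (0 : ℝ), ∃ S S' : H →L[ℂ] H, ‖S‖ < 1 ∧ ‖S'‖ < 1 ∧
      negRoot (genSum T₀ A B) E = negRoot T₀ E * (1 - S) ∧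
      negRoot (genSum T₀ A B) E = (1 - S') * negRoot T₀ E := by
  have h0 := hsqrt.mAccretive.hasContractiveResolvents
  have hfam := h0.isResolventFamily
  obtain ⟨r, hr, E₀, hE₀, hint, hlim, hν⟩ := hsqrt.decay
  set ν : ℝ → ℝ := fun e => normA T₀ A e * normB T₀ B e
  -- `12 / 24 < 1` makes `I - S` and `I - S'` invertible.
  have hε : (0 : ℝ) < 1 / 24 := by norm_num
  obtain ⟨E₁, hE₁⟩ := eventually_atTop.1 (hν.eventually_le_const hε)
  obtain ⟨E₂, hE₂⟩ := eventually_atTop.1 (hlim.eventually_le_const hε)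
  set E := max (max r E₀) (max E₁ E₂)
  have hrE : r ≤ E := (le_max_left _ _).trans (le_max_left _ _)
  have hE : 0 < E := hr.trans_le hrE
  have hE0 : E₀ ≤ E := (le_max_right _ _).trans (le_max_left _ _)
  have hE1 : E₁ ≤ E := (le_max_left _ _).trans (le_max_right _ _)
  have hE2 : E₂ ≤ E := (le_max_right _ _).trans (le_max_right _ _)
  have hν1 : ∀ s, E ≤ s → ν s ≤ 1 / 24 := fun s hs => hE₁ s (hE1.trans hs)
  have hν2 : ∀ s, E ≤ s → normA T₀ A s * normB T₀ B s ≤ 1 / 2 := fun s hs =>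
    (hν1 s hs).trans (by norm_num)
  have hν0 : ∀ s, 0 ≤ ν s := fun s => mul_nonneg (norm_nonneg _) (norm_nonneg _)
  have hres : ∀ s, E ≤ s → negRes (genSum T₀ A B) s =
      negRes T₀ s - negRoot T₀ s * middle T₀ A B s * negRoot T₀ s := fun s hs =>
    negRes_genSum h0 hsum.closed_A hsqrt.dom_A hsum.closed_B hsum.dense_B hsqrt.dom_B hT
      (hE.trans_le hs) (hν2 s hs)
  have hcX := continuousOn_middle h0 hsum.closed_A hsqrt.dom_A hsum.closed_B hsum.dense_B
    hsqrt.dom_B hE hν2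
  have hcM := hfam.continuousOn_sqrtRatio (norm_one_clm_le H) hE
  have hcJ : ContinuousOn (negRoot T₀) (Set.Ici E) :=
    (continuousOn_const.mul hcM).congr fun s hs => (hfam.negHalf_mul_sqrtRatio hE hs).symm
  have hshift : ContinuousOn (fun l : ℝ => l + E) (Set.Ioi 0) := by fun_prop
  have hmaps : Set.MapsTo (fun l : ℝ => l + E) (Set.Ioi 0) (Set.Ici E) := fun l hl =>
    Set.mem_Ici.2 (le_add_of_nonneg_left (le_of_lt (Set.mem_Ioi.1 hl)))
  let M := fun l : ℝ => sqrtRatio (negRes T₀) E (l + E)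
  let X := fun l : ℝ => middle T₀ A B (l + E)
  let J := fun l : ℝ => negRoot T₀ (l + E)
  have hcM' : ContinuousOn M (Set.Ioi 0) := hcM.comp hshift hmaps
  have hcX' : ContinuousOn X (Set.Ioi 0) := hcX.comp hshift hmaps
  have hcJ' : ContinuousOn J (Set.Ioi 0) := hcJ.comp hshift hmaps
  have hbd : ∀ l : ℝ, 0 < l → ‖M l‖ * ‖X l‖ * ‖J l‖ ≤ 4 * ν (l + E) * (√(l + E))⁻¹ := by
    intro l hl
    have hle : E ≤ l + E := hmaps hl
    have h1 : ‖M l‖ ≤ 2 := hfam.norm_sqrtRatio_le (norm_one_clm_le H) hE hle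
    have h2 : ‖X l‖ ≤ 2 * ν (l + E) := norm_middle_le (hν2 _ hle)
    have h3 : ‖J l‖ ≤ (√(l + E))⁻¹ := hfam.norm_negHalf_le (hE.trans_le hle)
    calc ‖M l‖ * ‖X l‖ * ‖J l‖ ≤ 2 * (2 * ν (l + E)) * (√(l + E))⁻¹ := by
          exact mul_le_mul (mul_le_mul h1 h2 (norm_nonneg _) zero_le_two) h3 (norm_nonneg _)
            (mul_nonneg zero_le_two (mul_nonneg zero_le_two (hν0 _)))
      _ = 4 * ν (l + E) * (√(l + E))⁻¹ := by ring
  obtain ⟨hi1, hS1⟩ := halfMean_estimate (F := fun l => M l * X l * J l)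
    (ν := fun l => ν (l + E)) (ε := 1 / 24) hr hrE ((hcM'.mul hcX').mul hcJ')
    (fun l _ => hν0 _) (fun l hl => hν1 _ (hmaps hl))
    (fun l hl => norm_mul₃_le.trans (hbd l hl))
    (hint E hE0) (hE₂ E hE2)
  obtain ⟨hi2, hS2⟩ := halfMean_estimate (F := fun l => J l * X l * M l)
    (ν := fun l => ν (l + E)) (ε := 1 / 24) hr hrE ((hcJ'.mul hcX').mul hcM')
    (fun l _ => hν0 _) (fun l hl => hν1 _ (hmaps hl))
    (fun l hl => norm_mul₃_le.trans ((hbd l hl).trans' (le_of_eq (by ring))))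
    (hint E hE0) (hE₂ E hE2)
  have hm1 := map_halfMean (ContinuousLinearMap.mul ℝ (H →L[ℂ] H) (negRoot T₀ E)) hi1
  have hm2 := map_halfMean ((ContinuousLinearMap.mul ℝ (H →L[ℂ] H)).flip (negRoot T₀ E)) hi2
  have hi1' := (ContinuousLinearMap.mul ℝ (H →L[ℂ] H) (negRoot T₀ E)).integrable_comp hi1
  have hi2' := ((ContinuousLinearMap.mul ℝ (H →L[ℂ] H)).flip (negRoot T₀ E)).integrable_comp hi2
  simp only [ContinuousLinearMap.flip_apply, ContinuousLinearMap.mul_apply',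
    mul_smul_comm, smul_mul_assoc] at hm1 hm2 hi1' hi2'
  have hiR := hfam.integrableOn hE
  refine ⟨E, hE, halfMean fun l => M l * X l * J l, halfMean fun l => J l * X l * M l,
    hS1.trans_lt (by norm_num), hS2.trans_lt (by norm_num), ?_, ?_⟩
  · rw [mul_sub, mul_one, ← hm1]
    change halfMean _ = halfMean _ - _
    rw [← halfMean_sub hiR hi1']
    refine halfMean_congr fun l hl => ?_
    have hJ : negRoot T₀ E * M l = J l := hfam.negHalf_mul_sqrtRatio hE (hmaps hl)
    rw [hres _ (hmaps hl), ← mul_assoc, ← mul_assoc, hJ]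
  · rw [sub_mul, one_mul, ← hm2]
    change halfMean _ = halfMean _ - _
    rw [← halfMean_sub hiR hi2']
    refine halfMean_congr fun l hl => ?_
    have hJ : M l * negRoot T₀ E = J l := hfam.sqrtRatio_mul_negHalf hE (hmaps hl)
    rw [hres _ (hmaps hl), mul_assoc (J l * X l), hJ]

end Main

end KatoSum

end

theorem corollary2p7 {H K : Type*}
    [NormedAddCommGroup H] [InnerProductSpace ℂ H] [CompleteSpace H]
    [NormedAddCommGroup K] [InnerProductSpace ℂ K] [CompleteSpace K]
    (T₀ : H →ₗ.[ℂ] H) (A B : H →ₗ.[ℂ] K)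
    (hsum : KatoSum.SumHyp T₀ A B) (hsqrt : KatoSum.SqrtHyp T₀ A B)
    (hT : KatoSum.IsMAccretive (KatoSum.genSum T₀ A B)) :
    (KatoSum.sqrt (KatoSum.genSum T₀ A B)).domain = (KatoSum.sqrt T₀).domain ∧
      (KatoSum.sqrt T₀).domain = (KatoSum.sqrt T₀.adjoint).domain ∧
      (KatoSum.sqrt T₀.adjoint).domain =
        (KatoSum.sqrt (KatoSum.genSum T₀ A B).adjoint).domain := by
  have h0 := hsqrt.mAccretive.hasContractiveResolvents
  have hT' := hT.hasContractiveResolvents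
  obtain ⟨E, hE, S, S', hS, hS', h1, h2⟩ := KatoSum.exists_negRoot_genSum_eq hsum hsqrt hT'
  refine ⟨?_, hsqrt.dom_eq, ?_⟩
  · refine SetLike.coe_injective ?_
    rw [hT'.sqrt_domain hE, h0.sqrt_domain hE]
    rw [h1, KatoSum.range_mul_one_sub _ hS]
  · refine SetLike.coe_injective ?_
    rw [hT'.adjoint.sqrt_domain hE, h0.adjoint.sqrt_domain hE, hT'.negRoot_adjoint hE,
      h0.negRoot_adjoint hE, h2]
    have h3 : ContinuousLinearMap.adjoint ((1 - S') * KatoSum.negRoot T₀ E) =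
        ContinuousLinearMap.adjoint (KatoSum.negRoot T₀ E) *
          (1 - ContinuousLinearMap.adjoint S') := by
      change star _ = star _ * (1 - star S')
      rw [star_mul, star_sub, star_one]
    rw [h3, KatoSum.range_mul_one_sub]
    rwa [LinearIsometryEquiv.norm_map]
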